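/- All graphs are finite and simple. A block of a graph is a maximal connected subgraph without a cut vertex. A graph is pseudo-outerplanar if each of its blocks can be drawn in the plane so that its vertices are distinct points of a circle, its edges are simple arcs joining their ends, lying in the closed disk bounded by this circle and passing through no other vertex, and each edge crosses at most one other edge (two distinct edges cross if the interiors of their arcs have a common point). A $k$-total coloring of $G$ is an assignment of colors from a set of $k$ colors to the vertices and edges of $G$ such that adjacent or incident elements receive different colors, and $\chi''(G)$ is the least positive integer $k$ for which $G$ has a $k$-total coloring. Theorem. Let $G$ be a pseudo-outerplanar graph with maximum degree $\Delta$, and let $M$ be an integer with $\Delta \le M$ and $M \ge 5$. Then $G$ has an $(M+1)$-total coloring; that is, $\chi''(G) \le M+1$. -/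

import Mathlib

/-- A total coloring of `G` with colors in `α`: adjacent or incident elements
(vertices and edges) receive different colors. -/
structure SimpleGraph.TotalColoring {V : Type*} (G : SimpleGraph V) (α : Type*) where
  vertexColor : V → α
  edgeColor : G.edgeSet → α
  vertex_ne : ∀ u v : V, G.Adj u v → vertexColor u ≠ vertexColor v
  edge_ne : ∀ e f : G.edgeSet, e ≠ f → ∀ v : V, v ∈ e.1 → v ∈ f.1 → edgeColor e ≠ edgeColor f
  incident_ne : ∀ (v : V) (e : G.edgeSet), v ∈ e.1 → vertexColor v ≠ edgeColor e

/-- `G` has a `k`-total coloring. -/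
def SimpleGraph.TotalColorable {V : Type*} (G : SimpleGraph V) (k : ℕ) : Prop :=
  Nonempty (G.TotalColoring (Fin k))

/-- The total chromatic number `χ''(G)`: the least positive `k` such that `G` has a `k`-total
coloring (and `⊤` if there is none, which cannot happen for a finite graph). -/
noncomputable def SimpleGraph.totalChromaticNumber {V : Type*} (G : SimpleGraph V) : ℕ∞ :=
  ⨅ k ∈ {k : ℕ | 0 < k ∧ G.TotalColorable k}, (k : ℕ∞)

/-- A subgraph that is connected (hence non-empty) and has no cut vertex. -/
def SimpleGraph.Subgraph.IsNonseparable {V : Type*} {G : SimpleGraph V} (H : G.Subgraph) : Prop :=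
  H.Connected ∧ ∀ v ∈ H.verts, (H.deleteVerts {v}).Preconnected

/-- A block of `G`: a maximal connected subgraph without a cut vertex. -/
def SimpleGraph.Subgraph.IsBlock {V : Type*} {G : SimpleGraph V} (H : G.Subgraph) : Prop :=
  Maximal SimpleGraph.Subgraph.IsNonseparable H

/-- A drawing of `G` in the plane (identified with `ℂ`) such that the vertices are distinct points
of a circle, and every edge is a simple arc that joins its two ends, lies in the closed disk bounded
by the circle, and passes through no vertex other than its ends. -/
structure SimpleGraph.DiskDrawing {V : Type*} (G : SimpleGraph V) where
  center : ℂ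
  radius : ℝ
  radius_pos : 0 < radius
  point : V → ℂ
  point_injective : Function.Injective point
  point_mem_sphere : ∀ v : V, point v ∈ Metric.sphere center radius
  curve : G.edgeSet → C(unitInterval, ℂ)
  curve_injective : ∀ e : G.edgeSet, Function.Injective (curve e)
  curve_ends : ∀ e : G.edgeSet, s(curve e 0, curve e 1) = Sym2.map point e.1
  curve_mem_disk : ∀ (e : G.edgeSet) (t : unitInterval),
    curve e t ∈ Metric.closedBall center radius
  curve_ne_point : ∀ (e : G.edgeSet) (t : unitInterval), t ∈ Set.Ioo 0 1 →
    ∀ v : V, curve e t ≠ point v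

/-- Two edges cross in a drawing if they are distinct and have a common point in the interiors
of their arcs. -/
def SimpleGraph.DiskDrawing.Crosses {V : Type*} {G : SimpleGraph V} (D : G.DiskDrawing)
    (e f : G.edgeSet) : Prop :=
  e ≠ f ∧ ((D.curve e '' Set.Ioo 0 1) ∩ (D.curve f '' Set.Ioo 0 1)).Nonempty

/-- `G` is pseudo-outerplanar: each block of `G` has a drawing with the vertices on a circle and the
edges inside the disk of this circle such that each edge crosses at most one other edge. -/
def SimpleGraph.IsPseudoOuterplanar {V : Type*} (G : SimpleGraph V) : Prop :=
  ∀ B : G.Subgraph, B.IsBlock →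
    ∃ D : B.coe.DiskDrawing, ∀ e f g : B.coe.edgeSet, D.Crosses e f → D.Crosses e g → f = g

/-! ### Topology: curves in a disk with alternating ends -/

section DiskCurves

open Complex

/-! The proof is an induction on subgraphs with reducible and unavoidable configurations, after the
drawings have been turned into chords of a circle.

Topology enters once: two curves in a closed disk whose ends alternate on the circle meet
(`exists_eq_of_alternating_disk`). Hence replacing the arcs in a drawing of a block by chords
creates no new crossing pair. Gluing the orders of the blocks at cut vertices gives one linear order
of all vertices in which each chord crosses at most one other (`IsPseudoOuterplanar.exists_layout`).
Unlike a family of drawings of blocks, this order visibly serves every subgraph.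

With at least six colors, and more colors than any degree, three configurations are reducible: a
vertex with one neighbour, or with two of which one has small degree; twins; a chain. In each case a
few vertices are isolated, the rest is colored by induction, and the remaining colors are counted.

If the first configuration is absent (`SmallDegreeCondition`), take an uncrossed chord `ab` with at
least two non-isolated vertices strictly inside and as few as possible. Some crossing `uw`, `vz`
with `u < v < w < z` lies within `[a, b]`. The chords `uv`, `vw`, `wz` are uncrossed, since an edge
crossing one of them would be a second edge crossing `uw` or `vz`. By minimality each spans at most
one non-isolated vertex, and such a vertex forces degree at least five at both ends of its chord.
Counting neighbours of `v` and `w`: if `vw` spans a vertex, so do `uv` and `wz`, and this is a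
chain; otherwise none of the three does, and `v`, `w` are twins
(`CrossesAtMostOnce.hasTwins_or_hasChain`). -/

lemma log_one_sub_exp_im {θ : ℝ} (h0 : 0 < θ) (h1 : θ < 2 * Real.pi) :
    (log (1 - exp (θ * I))).im = (θ - Real.pi) / 2 := by
  have hs : 0 < 2 * Real.sin (θ / 2) :=
    mul_pos two_pos (Real.sin_pos_of_pos_of_lt_pi (by linarith) (by linarith))
  have hcos : Real.cos ((θ - Real.pi) / 2) = Real.sin (θ / 2) := by
    rw [sub_div, Real.cos_sub_pi_div_two]
  have hsin : Real.sin ((θ - Real.pi) / 2) = -Real.cos (θ / 2) := by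
    rw [sub_div, Real.sin_sub_pi_div_two]
  have key : 1 - exp (θ * I) = ((2 * Real.sin (θ / 2) : ℝ) : ℂ) *
      (cos (((θ - Real.pi) / 2 : ℝ) : ℂ) + sin (((θ - Real.pi) / 2 : ℝ) : ℂ) * I) := by
    rw [← ofReal_cos, ← ofReal_sin, hcos, hsin, exp_mul_I, ← ofReal_cos, ← ofReal_sin]
    have e1 : Real.cos θ = 1 - 2 * Real.sin (θ / 2) ^ 2 := by
      have := Real.cos_two_mul (θ / 2)
      rw [mul_div_cancel₀ _ two_ne_zero] at this
      rw [this, Real.cos_sq']; ring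
    have e2 : Real.sin θ = 2 * Real.sin (θ / 2) * Real.cos (θ / 2) := by
      have := Real.sin_two_mul (θ / 2)
      rwa [mul_div_cancel₀ _ two_ne_zero] at this
    rw [e1, e2]
    push_cast
    ring
  rw [key, log_im, arg_mul_cos_add_sin_mul_I hs]
  constructor <;> linarith

/-- The change of argument seen from a point `w` of the unit circle, along a curve in the closed
unit disk that avoids `w` and starts and ends on the circle. -/
lemma im_sub_of_exp_eq_sub {w : ℂ} (hw : ‖w‖ = 1) {f g : ℝ → ℂ} (hf : Continuous f)
    (hf1 : ∀ t, ‖f t‖ ≤ 1) (hfw : ∀ t, f t ≠ w) (hg : Continuous g)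
    (hgf : ∀ t, exp (g t) = w - f t) {φ₀ φ₁ : ℝ} (h0 : 0 < φ₀) (h0' : φ₀ < 2 * Real.pi)
    (h1 : 0 < φ₁) (h1' : φ₁ < 2 * Real.pi) (hf0 : f 0 = w * exp (φ₀ * I))
    (hf1' : f 1 = w * exp (φ₁ * I)) : (g 1).im - (g 0).im = (φ₁ - φ₀) / 2 := by
  have hw0 : w ≠ 0 := by rintro rfl; simp at hw
  -- A point of the closed unit disk other than 1 has real part less than 1, so the principal
  -- logarithm is continuous along `1 - f t / w`.
  have hslit : ∀ t, 1 - f t / w ∈ slitPlane := by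
    intro t
    left
    have hn : ‖f t / w‖ ≤ 1 := by rw [norm_div, hw, div_one]; exact hf1 t
    have hne : f t / w ≠ 1 := fun h => hfw t ((div_eq_one_iff_eq hw0).1 h)
    rw [sub_re, one_re, sub_pos]
    refine lt_of_le_of_ne ((re_le_norm _).trans hn) fun h => hne ?_
    have : (f t / w).im = 0 := by
      have h2 := Complex.sq_norm (f t / w)
      rw [normSq_apply, h] at h2
      nlinarith [norm_nonneg (f t / w), mul_self_nonneg (f t / w).im]
    exact Complex.ext (by simpa using h) (by simpa using this)
  have hcont : Continuous fun t => g t - log (1 - f t / w) :=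
    hg.sub (Continuous.clog (by fun_prop) hslit)
  have hexp : ∀ t, exp (g t - log (1 - f t / w)) = w := by
    intro t
    rw [exp_sub, hgf, exp_log (slitPlane_ne_zero (hslit t))]
    have := slitPlane_ne_zero (hslit t)
    rw [div_eq_iff this]
    field_simp
  -- The difference of the two logarithms lifts the constant `w` through `exp`, so it is constant.
  have hc := isCoveringMap_exp.const_of_comp hcont
    (fun a a' => Subtype.ext ((hexp a).trans (hexp a').symm)) 1 0
  have h2 := congrArg im hc
  simp only [sub_im] at h2
  rw [hf0, hf1', mul_div_cancel_left₀ _ hw0, mul_div_cancel_left₀ _ hw0,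
    log_one_sub_exp_im h0 h0', log_one_sub_exp_im h1 h1'] at h2
  linarith

lemma exp_mul_I_eq_mul (x y : ℝ) : exp (y * I) = exp (x * I) * exp ((y - x : ℝ) * I) := by
  rw [← exp_add]; push_cast; ring_nf

lemma exp_mul_I_eq_mul' (x y : ℝ) :
    exp (y * I) = exp (x * I) * exp ((y - x + 2 * Real.pi : ℝ) * I) := by
  rw [exp_mul_I_eq_mul x y]
  push_cast
  rw [add_mul ((y : ℂ) - x), exp_add (((y : ℂ) - x) * I), exp_two_pi_mul_I, mul_one]

lemma isSimplyConnected_univ (X : Type*) [TopologicalSpace X] [SimplyConnectedSpace X] :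
    IsSimplyConnected (Set.univ : Set X) :=
  (Homeomorph.Set.univ X).toHomotopyEquiv.simplyConnectedSpace

/-- Two curves in the closed unit disk whose ends alternate on the unit circle meet. -/
lemma exists_eq_of_alternating {α β γ δ : ℝ} (hαβ : α < β) (hβγ : β < γ) (hγδ : γ < δ)
    (hδα : δ < α + 2 * Real.pi) {a b : ℝ → ℂ} (ha : Continuous a) (hb : Continuous b)
    (ha1 : ∀ s, ‖a s‖ ≤ 1) (hb1 : ∀ s, ‖b s‖ ≤ 1) (hα : a 0 = exp (α * I))
    (hγ : a 1 = exp (γ * I)) (hβ : b 0 = exp (β * I)) (hδ : b 1 = exp (δ * I)) :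
    ∃ s t, a s = b t := by
  by_contra! hne
  -- If the curves do not meet, `a s - b t` has a continuous logarithm `G` on the plane. The changes
  -- of its imaginary part along the sides of the unit square are computed in `e1` to `e4`. The
  -- summand `2 * Real.pi` brings the angles into `(0, 2π)`; because of it the two ways round the
  -- square from `(0, 0)` to `(1, 1)` differ by `2π`.
  obtain ⟨G, hG, hGF⟩ := exists_continuousOn_eqOn_exp_comp (U := (Set.univ : Set (ℝ × ℝ)))
    (g := fun p => a p.1 - b p.2) (isSimplyConnected_univ (ℝ × ℝ)) isOpen_univ
    (by fun_prop) (by rintro ⟨p, -, hp⟩; exact hne _ _ (sub_eq_zero.1 hp))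
  rw [continuousOn_univ] at hG
  replace hGF : ∀ s t, exp (G (s, t)) = a s - b t := fun s t => hGF (Set.mem_univ (s, t))
  have hGF' : ∀ s t, exp (G (s, t) + Real.pi * I) = b t - a s := by
    intro s t
    rw [exp_add, hGF, exp_pi_mul_I]; ring
  have e1 := im_sub_of_exp_eq_sub (w := exp (α * I)) (norm_exp_ofReal_mul_I α) hb hb1
    (fun t => hα ▸ (hne 0 t).symm) (g := fun t => G (0, t)) (by fun_prop)
    (fun t => by rw [hGF, hα]) (φ₀ := β - α) (φ₁ := δ - α) (by linarith) (by linarith)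
    (by linarith) (by linarith) (hβ.trans (exp_mul_I_eq_mul _ _))
    (hδ.trans (exp_mul_I_eq_mul _ _))
  have e2 := im_sub_of_exp_eq_sub (w := exp (γ * I)) (norm_exp_ofReal_mul_I γ) hb hb1
    (fun t => hγ ▸ (hne 1 t).symm) (g := fun t => G (1, t)) (by fun_prop)
    (fun t => by rw [hGF, hγ]) (φ₀ := β - γ + 2 * Real.pi) (φ₁ := δ - γ) (by linarith)
    (by linarith) (by linarith) (by linarith) (hβ.trans (exp_mul_I_eq_mul' _ _))
    (hδ.trans (exp_mul_I_eq_mul _ _))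
  have e3 := im_sub_of_exp_eq_sub (w := exp (β * I)) (norm_exp_ofReal_mul_I β) ha ha1
    (fun t => hβ ▸ hne t 0) (g := fun t => G (t, 0) + Real.pi * I) (by fun_prop)
    (fun t => by rw [hGF', hβ]) (φ₀ := α - β + 2 * Real.pi) (φ₁ := γ - β) (by linarith)
    (by linarith) (by linarith) (by linarith) (hα.trans (exp_mul_I_eq_mul' _ _))
    (hγ.trans (exp_mul_I_eq_mul _ _))
  have e4 := im_sub_of_exp_eq_sub (w := exp (δ * I)) (norm_exp_ofReal_mul_I δ) ha ha1
    (fun t => hδ ▸ hne t 1) (g := fun t => G (t, 1) + Real.pi * I) (by fun_prop)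
    (fun t => by rw [hGF', hδ]) (φ₀ := α - δ + 2 * Real.pi) (φ₁ := γ - δ + 2 * Real.pi)
    (by linarith) (by linarith) (by linarith) (by linarith)
    (hα.trans (exp_mul_I_eq_mul' _ _)) (hγ.trans (exp_mul_I_eq_mul' _ _))
  simp only [add_im] at e1 e2 e3 e4
  linarith [Real.pi_pos]

/-- Two curves in a closed disk whose ends alternate on the bounding circle meet. -/
lemma exists_eq_of_alternating_disk {c z : ℂ} (hz : z ≠ 0) {α β γ δ : ℝ} (hαβ : α < β)
    (hβγ : β < γ) (hγδ : γ < δ) (hδα : δ < α + 2 * Real.pi) {a b : C(unitInterval, ℂ)}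
    (ha : ∀ s, ‖a s - c‖ ≤ ‖z‖) (hb : ∀ s, ‖b s - c‖ ≤ ‖z‖)
    (ha' : s(a 0, a 1) = s(c + z * exp (α * I), c + z * exp (γ * I)))
    (hb' : s(b 0, b 1) = s(c + z * exp (β * I), c + z * exp (δ * I))) :
    ∃ s t, a s = b t := by
  have orient : ∀ (f : C(unitInterval, ℂ)) (p q : ℂ), s(f 0, f 1) = s(p, q) →
      ∃ f' : C(unitInterval, ℂ), f' 0 = p ∧ f' 1 = q ∧ ∀ s, ∃ t, f' s = f t := by
    intro f p q h
    rcases Sym2.eq_iff.1 h with ⟨h0, h1⟩ | ⟨h0, h1⟩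
    · exact ⟨f, h0, h1, fun s => ⟨s, rfl⟩⟩
    · exact ⟨f.comp ⟨unitInterval.symm, unitInterval.continuous_symm⟩, by simpa using h1,
        by simpa using h0, fun s => ⟨_, rfl⟩⟩
  obtain ⟨a', ha0, ha1, haa⟩ := orient a _ _ ha'
  obtain ⟨b', hb0, hb1, hbb⟩ := orient b _ _ hb'
  have hzn : 0 < ‖z‖ := norm_pos_iff.2 hz
  have bound : ∀ (f f' : C(unitInterval, ℂ)), (∀ s, ‖f s - c‖ ≤ ‖z‖) →
      (∀ s, ∃ t, f' s = f t) → ∀ s, ‖(f' s - c) / z‖ ≤ 1 := by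
    intro f f' h h' s
    obtain ⟨t, ht⟩ := h' s
    rw [ht, norm_div, div_le_one hzn]
    exact h t
  obtain ⟨s, t, hst⟩ := exists_eq_of_alternating hαβ hβγ hγδ hδα
    (a := fun s => (a' (Set.projIcc 0 1 zero_le_one s) - c) / z)
    (b := fun s => (b' (Set.projIcc 0 1 zero_le_one s) - c) / z)
    (by have := continuous_projIcc (h := zero_le_one (α := ℝ)); fun_prop)
    (by have := continuous_projIcc (h := zero_le_one (α := ℝ)); fun_prop)
    (fun s => bound a a' ha haa _) (fun s => bound b b' hb hbb _)
    (by simp [ha0, hz]) (by simp [ha1, hz]) (by simp [hb0, hz]) (by simp [hb1, hz])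
  obtain ⟨s', hs'⟩ := haa (Set.projIcc 0 1 zero_le_one s)
  obtain ⟨t', ht'⟩ := hbb (Set.projIcc 0 1 zero_le_one t)
  refine ⟨s', t', ?_⟩
  rw [← hs', ← ht']
  have := (div_left_inj' hz).1 hst
  exact sub_left_injective this

end DiskCurves

/-! ### From drawings to chords -/

/-- The pairs `{a, c}` and `{b, d}` alternate, where `a` and `b` are the smaller elements. -/
def Interleave {α : Type*} [LT α] (a c b d : α) : Prop :=
  (a < b ∧ b < c ∧ c < d) ∨ (b < a ∧ a < d ∧ d < c)

/-- The vertices of `S` have distinct positions, and every edge inside `S`, drawn as a chord,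
crosses at most one other edge inside `S`. -/
def SimpleGraph.IsLayout {V α : Type*} [LT α] (G : SimpleGraph V) (S : Set V) (pos : V → α) :
    Prop :=
  S.InjOn pos ∧ ∀ a ∈ S, ∀ c ∈ S, ∀ b ∈ S, ∀ d ∈ S, ∀ b' ∈ S, ∀ d' ∈ S,
    G.Adj a c → G.Adj b d → G.Adj b' d' → Interleave (pos a) (pos c) (pos b) (pos d) →
    Interleave (pos a) (pos c) (pos b') (pos d') → b = b' ∧ d = d'

section Drawing

open Complex

lemma exists_angle {u : ℂ} (hu : ‖u‖ = 1) :
    ∃ θ : ℝ, 0 ≤ θ ∧ θ < 2 * Real.pi ∧ u = exp (θ * I) ∧ (u = 1 → θ = 0) := by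
  have h1 : u = exp (arg u * I) := by
    have := norm_mul_exp_arg_mul_I u
    rw [hu] at this
    simpa using this.symm
  rcases lt_or_ge (arg u) 0 with h | h
  · refine ⟨arg u + 2 * Real.pi, by linarith [neg_pi_lt_arg u], by linarith, ?_, ?_⟩
    · push_cast
      rw [add_mul, exp_add, exp_two_pi_mul_I, mul_one]
      exact h1
    · rintro rfl
      simp at h
  · exact ⟨arg u, h, by linarith [arg_le_pi u, Real.pi_pos], h1, by rintro rfl; simp⟩

namespace SimpleGraph.DiskDrawing

variable {V : Type*} {G : SimpleGraph V} (D : G.DiskDrawing)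

lemma exists_angles (v₀ : V) : ∃ (z : ℂ) (θ : V → ℝ), ‖z‖ = D.radius ∧
    (∀ v, 0 ≤ θ v ∧ θ v < 2 * Real.pi ∧ D.point v = D.center + z * exp (θ v * I)) ∧
    θ v₀ = 0 := by
  have hn : ∀ v, ‖D.point v - D.center‖ = D.radius := fun v => by
    simpa [dist_eq_norm] using D.point_mem_sphere v
  have hz : D.point v₀ - D.center ≠ 0 := by
    rw [← norm_pos_iff, hn]; exact D.radius_pos
  have hu : ∀ v, ‖(D.point v - D.center) / (D.point v₀ - D.center)‖ = 1 := fun v => by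
    rw [norm_div, hn, hn, div_self D.radius_pos.ne']
  choose θ h0 h1 h2 h3 using fun v => exists_angle (hu v)
  refine ⟨D.point v₀ - D.center, θ, hn v₀, fun v => ⟨h0 v, h1 v, ?_⟩, h3 v₀ (div_self hz)⟩
  rw [← h2, mul_div_cancel₀ _ hz]
  ring

lemma mem_of_curve_eq_point {e : G.edgeSet} {t : unitInterval} {v : V}
    (h : D.curve e t = D.point v) : v ∈ e.1 := by
  have key : D.curve e t ∈ s(D.curve e 0, D.curve e 1) → v ∈ e.1 := by
    rw [D.curve_ends e, h, Sym2.mem_map]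
    rintro ⟨w, hw, hwv⟩
    exact D.point_injective hwv ▸ hw
  by_cases ht : t ∈ Set.Ioo 0 1
  · exact absurd h (D.curve_ne_point e t ht v)
  · apply key
    rcases (unitInterval.nonneg' (t := t)).eq_or_lt with h0 | h0
    · rw [← h0]; exact Sym2.mem_mk_left _ _
    · rcases (unitInterval.le_one' (t := t)).eq_or_lt with h1 | h1
      · rw [h1]; exact Sym2.mem_mk_right _ _
      · exact absurd ⟨h0, h1⟩ ht

lemma exists_mem_of_notMem_Ioo {e : G.edgeSet} {t : unitInterval} (ht : t ∉ Set.Ioo 0 1) :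
    ∃ v ∈ e.1, D.curve e t = D.point v := by
  have key : D.curve e t ∈ s(D.curve e 0, D.curve e 1) := by
    rcases (unitInterval.nonneg' (t := t)).eq_or_lt with h0 | h0
    · rw [← h0]; exact Sym2.mem_mk_left _ _
    · rcases (unitInterval.le_one' (t := t)).eq_or_lt with h1 | h1
      · rw [h1]; exact Sym2.mem_mk_right _ _
      · exact absurd ⟨h0, h1⟩ ht
  rw [D.curve_ends e, Sym2.mem_map] at key
  obtain ⟨v, hv, h⟩ := key
  exact ⟨v, hv, h.symm⟩

lemma crosses_symm {D : G.DiskDrawing} {e f : G.edgeSet} (h : D.Crosses e f) : D.Crosses f e :=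
  ⟨h.1.symm, by rw [Set.inter_comm]; exact h.2⟩

/-- The arcs meet because their ends alternate. An arc passes through no vertices but its ends, and
the two edges share none, so the common point is interior to both arcs. -/
lemma crosses_of_lt {z : ℂ} {θ : V → ℝ} (hz : ‖z‖ = D.radius)
    (hθ : ∀ v, 0 ≤ θ v ∧ θ v < 2 * Real.pi ∧ D.point v = D.center + z * exp (θ v * I))
    {a b c d : V} (hac : G.Adj a c) (hbd : G.Adj b d) (h1 : θ a < θ b) (h2 : θ b < θ c)
    (h3 : θ c < θ d) : D.Crosses ⟨s(a, c), hac⟩ ⟨s(b, d), hbd⟩ := by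
  have hz0 : z ≠ 0 := by rw [← norm_pos_iff, hz]; exact D.radius_pos
  have hdisj : ∀ v, v ∈ s(a, c) → v ∈ s(b, d) → False := by
    intro v h h'
    rw [Sym2.mem_iff] at h h'
    rcases h with rfl | rfl <;> rcases h' with rfl | rfl <;> linarith
  have hb : ∀ (e : G.edgeSet) s, ‖D.curve e s - D.center‖ ≤ ‖z‖ := fun e s => by
    rw [hz]; simpa [dist_eq_norm] using D.curve_mem_disk e s
  obtain ⟨s, t, hst⟩ := exists_eq_of_alternating_disk hz0 h1 h2 h3
    (by linarith [(hθ a).1, (hθ d).2.1]) (hb ⟨s(a, c), hac⟩) (hb ⟨s(b, d), hbd⟩)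
    (by rw [D.curve_ends, ← (hθ a).2.2, ← (hθ c).2.2]; rfl)
    (by rw [D.curve_ends, ← (hθ b).2.2, ← (hθ d).2.2]; rfl)
  refine ⟨fun h => hdisj a (Sym2.mem_mk_left _ _) ?_, D.curve ⟨s(a, c), hac⟩ s,
    ⟨s, ?_, rfl⟩, ⟨t, ?_, hst.symm⟩⟩
  · rw [← Subtype.mk.inj h]; exact Sym2.mem_mk_left _ _
  · by_contra hs
    obtain ⟨v, hv, hv'⟩ := D.exists_mem_of_notMem_Ioo hs
    exact hdisj v hv (D.mem_of_curve_eq_point (hst.symm.trans hv'))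
  · by_contra ht
    obtain ⟨v, hv, hv'⟩ := D.exists_mem_of_notMem_Ioo ht
    exact hdisj v (D.mem_of_curve_eq_point (hst.trans hv')) hv

lemma exists_isLayout (hD : ∀ e f g : G.edgeSet, D.Crosses e f → D.Crosses e g → f = g) (v₀ : V) :
    ∃ θ : V → ℝ, θ v₀ = 0 ∧ (∀ v, 0 ≤ θ v) ∧ G.IsLayout Set.univ θ := by
  obtain ⟨z, θ, hz, hθ, h0⟩ := D.exists_angles v₀
  refine ⟨θ, h0, fun v => (hθ v).1, ?_, ?_⟩
  · intro u _ v _ huv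
    apply D.point_injective
    rw [(hθ u).2.2, (hθ v).2.2]
    rw [huv]
  · intro a _ c _ b _ d _ b' _ d' _ hac hbd hbd' h h'
    have cr : ∀ {b d} (hbd : G.Adj b d), Interleave (θ a) (θ c) (θ b) (θ d) →
        D.Crosses ⟨s(a, c), hac⟩ ⟨s(b, d), hbd⟩ := by
      rintro b d hbd (⟨h1, h2, h3⟩ | ⟨h1, h2, h3⟩)
      · exact D.crosses_of_lt hz hθ hac hbd h1 h2 h3
      · exact crosses_symm (D.crosses_of_lt hz hθ hbd hac h1 h2 h3)
    have heq := Subtype.mk.inj (hD _ _ _ (cr hbd h) (cr hbd' h'))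
    -- `Interleave` forces the third entry below the fourth, which excludes the swapped pair.
    rcases Sym2.eq_iff.1 heq with h1 | ⟨rfl, rfl⟩
    · exact h1
    · rcases h with h | h <;> rcases h' with h' | h' <;>
        linarith [h.1, h.2.1, h.2.2, h'.1, h'.2.1, h'.2.2]

end SimpleGraph.DiskDrawing

end Drawing

/-! ### Gluing the layouts of the blocks -/

namespace SimpleGraph

variable {V : Type*} {G : SimpleGraph V}

lemma IsLayout.of_lt_iff {α β : Type*} [LinearOrder α] [LinearOrder β] {S : Set V}
    {p : V → α} {q : V → β} (h : G.IsLayout S p) (hpq : ∀ u ∈ S, ∀ v ∈ S, q u < q v ↔ p u < p v) : G.IsLayout S q := by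
  refine ⟨fun u hu v hv huv => h.1 hu hv ?_, ?_⟩
  · have h1 := hpq u hu v hv
    have h2 := hpq v hv u hu
    rw [huv] at h1 h2
    simp only [lt_irrefl, false_iff, not_lt] at h1 h2
    exact le_antisymm h2 h1
  · intro a ha c hc b hb d hd b' hb' d' hd' hac hbd hbd' hi hi'
    simp only [Interleave, hpq _ ha _ hb, hpq _ hb _ hc, hpq _ hc _ hd, hpq _ hb _ ha,
      hpq _ ha _ hd, hpq _ hd _ hc] at hi
    simp only [Interleave, hpq _ ha _ hb', hpq _ hb' _ hc, hpq _ hc _ hd', hpq _ hb' _ ha,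
      hpq _ ha _ hd', hpq _ hd' _ hc] at hi'
    exact h.2 a ha c hc b hb d hd b' hb' d' hd' hac hbd hbd' hi hi'

/-- Only the order of the positions matters, so each is replaced by its rank in `S`. Integer
positions can be stretched to make room for an insertion. -/
lemma IsLayout.exists_nat [Finite V] {S : Set V} {θ : V → ℝ} (h : G.IsLayout S θ) {v₀ : V}
    (hv₀ : ∀ v ∈ S, θ v₀ ≤ θ v) : ∃ p : V → ℕ, p v₀ = 0 ∧ G.IsLayout S p := by
  refine ⟨fun v => {u ∈ S | θ u < θ v}.ncard, ?_, h.of_lt_iff fun u hu v hv => ?_⟩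
  · rw [Set.ncard_eq_zero, Set.eq_empty_iff_forall_notMem]
    rintro u ⟨hu, hlt⟩
    exact absurd (hv₀ u hu) (not_le.2 hlt)
  · constructor
    · intro hlt
      by_contra hle
      refine absurd (Set.ncard_le_ncard ?_) (not_le.2 hlt)
      exact fun w hw => ⟨hw.1, hw.2.trans_le (not_lt.1 hle)⟩
    · intro hlt
      apply Set.ncard_lt_ncard
      exact ⟨fun w hw => ⟨hw.1, hw.2.trans hlt⟩, fun hsub => lt_irrefl _ (hsub ⟨hu, hlt⟩).2⟩
      exact Set.toFinite _

/-- By finiteness the induced subgraph lies in a block, and the layout of the block, with angles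
measured from `v₀`, restricts to `S`. -/
lemma IsPseudoOuterplanar.exists_layout_of_isNonseparable [Finite V] (hG : G.IsPseudoOuterplanar)
    {S : Set V} (hS : ((⊤ : G.Subgraph).induce S).IsNonseparable) {v₀ : V} (hv₀ : v₀ ∈ S) :
    ∃ p : V → ℕ, p v₀ = 0 ∧ G.IsLayout S p := by
  obtain ⟨B, hSB, hB⟩ := (Set.toFinite {H : G.Subgraph | H.IsNonseparable}).exists_le_maximal hS
  obtain ⟨D, hD⟩ := hG B hB
  have hsub : S ⊆ B.verts := hSB.1
  obtain ⟨θ, h0, hpos, hθ⟩ := D.exists_isLayout hD ⟨v₀, hsub hv₀⟩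
  classical
  have hext : ∀ v (hv : v ∈ B.verts),
      (if h : v ∈ B.verts then θ ⟨v, h⟩ else 0) = θ ⟨v, hv⟩ := fun v hv => dif_pos hv
  refine IsLayout.exists_nat (θ := fun v => if h : v ∈ B.verts then θ ⟨v, h⟩ else 0) ⟨?_, ?_⟩ ?_
  · intro u hu v hv huv
    simp only [hext u (hsub hu), hext v (hsub hv)] at huv
    exact Subtype.mk.inj (hθ.1 trivial trivial huv)
  · intro a ha c hc b hb d hd b' hb' d' hd' hac hbd hbd' hi hi'
    simp only [hext a (hsub ha), hext c (hsub hc), hext b (hsub hb), hext d (hsub hd),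
      hext b' (hsub hb'), hext d' (hsub hd')] at hi hi'
    have adj : ∀ {u v}, u ∈ S → v ∈ S → G.Adj u v → B.Adj u v :=
      fun hu hv h => hSB.2 ⟨hu, hv, h⟩
    have := hθ.2 ⟨a, hsub ha⟩ trivial ⟨c, hsub hc⟩ trivial ⟨b, hsub hb⟩ trivial ⟨d, hsub hd⟩
      trivial ⟨b', hsub hb'⟩ trivial ⟨d', hsub hd'⟩ trivial (adj ha hc hac) (adj hb hd hbd)
      (adj hb' hd' hbd') hi hi'
    exact ⟨Subtype.mk.inj this.1, Subtype.mk.inj this.2⟩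
  · intro v hv
    simp only [hext v (hsub hv), hext v₀ (hsub hv₀)]
    rw [h0]
    exact hpos _

lemma exists_split {S : Set V} (h : ¬ ((⊤ : G.Subgraph).induce S).Preconnected) :
    ∃ P ⊆ S, P.Nonempty ∧ (S \ P).Nonempty ∧ ∀ u ∈ P, ∀ w ∈ S \ P, ¬ G.Adj u w := by
  rw [Subgraph.preconnected_iff, Preconnected] at h
  push Not at h
  obtain ⟨x, y, hxy⟩ := h
  refine ⟨{w | ∃ hw : w ∈ S, ((⊤ : G.Subgraph).induce S).coe.Reachable x ⟨w, hw⟩},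
    fun w hw => hw.1, ⟨x, x.2, .refl _⟩, ⟨y, y.2, fun hy => hxy hy.2⟩, ?_⟩
  rintro u ⟨hu, hxu⟩ w ⟨hw, hxw⟩ huw
  refine hxw ⟨hw, hxu.trans (Adj.reachable ?_)⟩
  exact ⟨hu, hw, huw⟩

/-- Two layouts that share at most a vertex `v`, which comes first in the second one, combine to a
layout in which the second one takes the place of `v`. -/
lemma IsLayout.union {S T : Set V} {p q : V → ℕ} (hp : G.IsLayout S p) (hq : G.IsLayout T q)
    {v : V} (hv : v ∈ S) (hST : ∀ w ∈ S, w ∈ T → w = v) (hqv : v ∈ T → q v = 0)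
    (hadj : ∀ u ∈ S, ∀ w ∈ T, u ∉ T → w ∉ S → ¬ G.Adj u w) {N : ℕ} (hN0 : 0 < N)
    (hN : ∀ w ∈ T, q w + 1 < N)
    [DecidablePred (· ∈ S)] :
    G.IsLayout (S ∪ T) (fun w => if w ∈ S then N * p w else N * p v + 1 + q w) := by
  -- The factor `N` opens a gap after `v` into which the rest of `T` is inserted. The summand 1
  -- keeps this part off the position of `v`, even when `v ∉ T` and `q` takes the value 0.
  set f : V → ℕ := fun w => if w ∈ S then N * p w else N * p v + 1 + q w with hf
  have fS : ∀ w ∈ S, f w = N * p w := fun w hw => if_pos hw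
  have fT : ∀ w ∈ T, w ≠ v → f w = N * p v + 1 + q w := fun w hw hne =>
    if_neg fun h => hne (hST w h hw)
  have fv : f v = N * p v := fS v hv
  have rangeT : ∀ w ∈ T, N * p v ≤ f w ∧ f w < N * p v + N := by
    intro w hw
    have := hN w hw
    by_cases hwv : w = v
    · rw [hwv, fv]; omega
    · rw [fT w hw hwv]; omega
  have rangeS : ∀ w ∈ S, f w ≤ N * p v ∨ N * p v + N ≤ f w := by
    intro w hw
    rw [fS w hw]
    rcases le_or_gt (p w) (p v) with h | h
    · exact Or.inl (Nat.mul_le_mul_left _ h)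
    · right
      calc N * p v + N = N * (p v + 1) := by ring
        _ ≤ N * p w := Nat.mul_le_mul_left _ h
  have ltT : ∀ u ∈ T, ∀ w ∈ T, f u < f w ↔ q u < q w := by
    intro u hu w hw
    by_cases huv : u = v <;> by_cases hwv : w = v
    · rw [huv, hwv]; simp
    · rw [huv, fv, fT w hw hwv, hqv (huv ▸ hu)]
      have : q w ≠ 0 := fun h => hwv (hq.1 hw (huv ▸ hu) (h.trans (hqv (huv ▸ hu)).symm))
      omega
    · rw [hwv, fv, fT u hu huv, hqv (hwv ▸ hw)]
      omega
    · rw [fT u hu huv, fT w hw hwv]; omega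
  have ltS : ∀ u ∈ S, ∀ w ∈ S, f u < f w ↔ p u < p w := by
    intro u hu w hw
    rw [fS u hu, fS w hw, Nat.mul_lt_mul_left hN0]
  have hp' := hp.of_lt_iff ltS
  have hq' := hq.of_lt_iff ltT
  have hedge : ∀ u ∈ S ∪ T, ∀ w ∈ S ∪ T, G.Adj u w → (u ∈ S ∧ w ∈ S) ∨ (u ∈ T ∧ w ∈ T) := by
    rintro u (hu | hu) w (hw | hw) huw
    · exact Or.inl ⟨hu, hw⟩
    · by_contra! hcon
      exact hadj u hu w hw (fun h => hcon.2 h hw) (hcon.1 hu) huw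
    · by_contra! hcon
      exact hadj w hw u hu (hcon.2 hu) (fun h => hcon.1 h hw) huw.symm
    · exact Or.inr ⟨hu, hw⟩
  -- `T` fills an interval with no position of `S` in it except possibly that of `v` at its left
  -- end, so no chord of `S` separates two points of `T`.
  have hcross : ∀ a ∈ S, ∀ c ∈ S, ∀ b ∈ T, ∀ d ∈ T, ¬ Interleave (f a) (f c) (f b) (f d) := by
    intro a ha c hc b hb d hd h
    have h1 := rangeS a ha
    have h2 := rangeS c hc
    have h3 := rangeT b hb
    have h4 := rangeT d hd
    rcases h with h | h <;> omega
  have hcross' : ∀ a ∈ T, ∀ c ∈ T, ∀ b ∈ S, ∀ d ∈ S, ¬ Interleave (f a) (f c) (f b) (f d) :=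
    fun a ha c hc b hb d hd h => hcross b hb d hd a ha c hc h.symm
  constructor
  · rintro u (hu | hu) w (hw | hw) huw
    · exact hp'.1 hu hw huw
    · by_cases hwv : w = v
      · exact hp'.1 hu (hwv ▸ hv) huw
      · exfalso
        have h1 := rangeS u hu
        have h2 := fT w hw hwv
        have h3 := rangeT w hw
        omega
    · by_cases huv : u = v
      · exact hp'.1 (huv ▸ hv) hw huw
      · exfalso
        have h1 := rangeS w hw
        have h2 := fT u hu huv
        have h3 := rangeT u hu
        omega
    · exact hq'.1 hu hw huw
  · intro a ha c hc b hb d hd b' hb' d' hd' hac hbd hbd' hi hi'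
    rcases hedge a ha c hc hac with ⟨ha, hc⟩ | ⟨ha, hc⟩ <;>
      rcases hedge b hb d hd hbd with ⟨hb, hd⟩ | ⟨hb, hd⟩ <;>
      rcases hedge b' hb' d' hd' hbd' with ⟨hb', hd'⟩ | ⟨hb', hd'⟩
    · exact hp'.2 a ha c hc b hb d hd b' hb' d' hd' hac hbd hbd' hi hi'
    · exact absurd hi' (hcross a ha c hc b' hb' d' hd')
    · exact absurd hi (hcross a ha c hc b hb d hd)
    · exact absurd hi (hcross a ha c hc b hb d hd)
    · exact absurd hi (hcross' a ha c hc b hb d hd)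
    · exact absurd hi (hcross' a ha c hc b hb d hd)
    · exact absurd hi' (hcross' a ha c hc b' hb' d' hd')
    · exact hq'.2 a ha c hc b hb d hd b' hb' d' hd' hac hbd hbd' hi hi'

lemma exists_layout_union [Finite V] {S T : Set V}
    (hT : ∀ v ∈ T, ∃ q : V → ℕ, q v = 0 ∧ G.IsLayout T q)
    {v₀ v : V} (hv : v ∈ S) (hv₀ : v₀ ∈ S)
    (hS : ∃ p : V → ℕ, p v₀ = 0 ∧ G.IsLayout S p)
    (hST : ∀ w ∈ S, w ∈ T → w = v) (hne : T.Nonempty)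
    (hadj : ∀ u ∈ S, ∀ w ∈ T, u ∉ T → w ∉ S → ¬ G.Adj u w) :
    ∃ p : V → ℕ, p v₀ = 0 ∧ G.IsLayout (S ∪ T) p := by
  classical
  obtain ⟨p, hp0, hp⟩ := hS
  obtain ⟨q, hqv, hq⟩ : ∃ q : V → ℕ, (v ∈ T → q v = 0) ∧ G.IsLayout T q := by
    by_cases hvT : v ∈ T
    · obtain ⟨q, h0, h⟩ := hT v hvT
      exact ⟨q, fun _ => h0, h⟩
    · obtain ⟨t, ht⟩ := hne
      obtain ⟨q, -, h⟩ := hT t ht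
      exact ⟨q, fun h => absurd h hvT, h⟩
  obtain ⟨N, hN⟩ := (Set.toFinite (Set.range q)).bddAbove
  refine ⟨_, ?_, hp.union hq hv hST hqv hadj (N := N + 2) (by omega) fun w _ => ?_⟩
  · simp [hv₀, hp0]
  · have := hN (Set.mem_range_self w)
    omega

/-- Strong induction on the size of `S`: either `S` induces a nonseparable subgraph, or it splits at
a cut vertex or into parts with no edges between them. The freedom to put any chosen vertex first is
what allows one part to be inserted at the cut vertex of the other. -/
theorem IsPseudoOuterplanar.exists_layout_of_mem [Finite V] (hG : G.IsPseudoOuterplanar) (n : ℕ) :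
    ∀ (S : Set V), S.ncard = n → ∀ v₀ ∈ S, ∃ p : V → ℕ, p v₀ = 0 ∧ G.IsLayout S p := by
  induction n using Nat.strong_induction_on with
  | _ n ih =>
  intro S hn v₀ hv₀
  subst hn
  replace ih : ∀ T, T ⊂ S → ∀ v ∈ T, ∃ p : V → ℕ, p v = 0 ∧ G.IsLayout T p :=
    fun T hT => ih _ (Set.ncard_lt_ncard hT (Set.toFinite _)) T rfl
  by_cases hconn : ((⊤ : G.Subgraph).induce S).Preconnected
  · by_cases hcut : ∀ v ∈ S, (((⊤ : G.Subgraph).induce S).deleteVerts {v}).Preconnected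
    · refine hG.exists_layout_of_isNonseparable ⟨?_, hcut⟩ hv₀
      exact Subgraph.connected_iff.2 ⟨hconn, v₀, hv₀⟩
    · push Not at hcut
      obtain ⟨v, hv, hcut⟩ := hcut
      have hdel : ((⊤ : G.Subgraph).induce S).deleteVerts {v} =
          (⊤ : G.Subgraph).induce (S \ {v}) := by
        ext a b
        · simp
        · simp
          tauto
      rw [hdel] at hcut
      obtain ⟨P, hPS, hP, hQ, hPQ⟩ := exists_split hcut
      -- The part that contains `v₀` must be the one that receives the other, so the argument is
      -- stated for either choice of `P`.
      have main : ∀ P ⊆ S \ {v}, P.Nonempty → (((S \ {v}) \ P).Nonempty) →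
          (∀ u ∈ P, ∀ w ∈ (S \ {v}) \ P, ¬ G.Adj u w) → v₀ ∈ insert v P →
          ∃ p : V → ℕ, p v₀ = 0 ∧ G.IsLayout S p := by
        intro P hPS hP hQ hPQ hv₀P
        have hS : S = insert v P ∪ insert v ((S \ {v}) \ P) := by
          ext w
          by_cases hw : w = v
          · simp [hw, hv]
          · have := @hPS w
            simp only [Set.mem_sdiff, Set.mem_singleton_iff, hw, not_false_eq_true, and_true,
              Set.mem_union, Set.mem_insert_iff, false_or] at this ⊢
            tauto
        rw [hS]
        obtain ⟨x, hx⟩ := hP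
        obtain ⟨y, hy⟩ := hQ
        refine exists_layout_union (v := v) (ih _ ?_) (Set.mem_insert _ _) hv₀P (ih _ ?_ _ hv₀P) ?_
          ⟨v, Set.mem_insert _ _⟩ ?_
        · refine ⟨by rintro w (rfl | hw); exacts [hv, hw.1.1], fun h => ?_⟩
          rcases h (hPS hx).1 with h | h
          exacts [(hPS hx).2 h, h.2 hx]
        · refine ⟨by rintro w (rfl | hw); exacts [hv, (hPS hw).1], fun h => ?_⟩
          rcases h hy.1.1 with h | h
          exacts [hy.1.2 h, hy.2 h]
        · rintro w (rfl | hw) (h | h)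
          exacts [rfl, rfl, h, absurd hw h.2]
        · rintro u (rfl | hu) w (rfl | hw) hu' hw'
          · exact absurd (Set.mem_insert _ _) hu'
          · exact absurd (Set.mem_insert _ _) hu'
          · exact absurd (Set.mem_insert _ _) hw'
          · exact hPQ u hu w hw
      by_cases h0 : v₀ ∈ insert v P
      · exact main P hPS hP hQ hPQ h0
      · have hPc : (S \ {v}) \ ((S \ {v}) \ P) = P := Set.sdiff_sdiff_cancel_left hPS
        refine main ((S \ {v}) \ P) Set.sdiff_subset hQ (hPc.symm ▸ hP :) ?_ ?_
        · rw [hPc]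
          exact fun u hu w hw h => hPQ w hw u hu h.symm
        · exact Or.inr ⟨⟨hv₀, fun h => h0 (Or.inl h)⟩, fun h => h0 (Or.inr h)⟩
  · obtain ⟨P, hPS, hP, hQ, hPQ⟩ := exists_split hconn
    have main : ∀ P ⊆ S, P.Nonempty → (S \ P).Nonempty →
        (∀ u ∈ P, ∀ w ∈ S \ P, ¬ G.Adj u w) → v₀ ∈ P →
        ∃ p : V → ℕ, p v₀ = 0 ∧ G.IsLayout S p := by
      intro P hPS hP hQ hPQ hv₀P
      rw [← Set.union_sdiff_cancel hPS]
      obtain ⟨x, hx⟩ := hP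
      obtain ⟨y, hy⟩ := hQ
      refine exists_layout_union (ih _ ?_) hv₀P hv₀P (ih _ ?_ _ hv₀P) ?_ ⟨y, hy⟩ ?_
      · exact ⟨Set.sdiff_subset, fun h => (h (hPS hx)).2 hx⟩
      · exact ⟨hPS, fun h => hy.2 (h hy.1)⟩
      · exact fun w hw hw' => absurd hw hw'.2
      · exact fun u hu w hw _ _ => hPQ u hu w hw
    by_cases h0 : v₀ ∈ P
    · exact main P hPS hP hQ hPQ h0
    · have hPc : S \ (S \ P) = P := Set.sdiff_sdiff_cancel_left hPS
      refine main (S \ P) Set.sdiff_subset hQ (hPc.symm ▸ hP :) ?_ ⟨hv₀, h0⟩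
      rw [hPc]
      exact fun u hu w hw h => hPQ w hw u hu h.symm

/-- The vertices of a pseudo-outerplanar graph can be put in an order in which every edge, drawn as
a chord, crosses at most one other edge. -/
theorem IsPseudoOuterplanar.exists_layout [Finite V] (hG : G.IsPseudoOuterplanar) :
    ∃ p : V → ℕ, G.IsLayout Set.univ p := by
  rcases isEmpty_or_nonempty V with h | ⟨⟨v⟩⟩
  · exact ⟨fun _ => 0, fun u => isEmptyElim u, fun u => isEmptyElim u⟩
  · obtain ⟨p, -, hp⟩ := hG.exists_layout_of_mem _ Set.univ rfl v trivial
    exact ⟨p, hp⟩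

end SimpleGraph

/-! ### Choosing colors from lists -/

section ColorChoice

variable {α : Type*}

lemma exists_notMem_list [Fintype α] (l : List α) (h : l.length < Fintype.card α) : ∃ k, k ∉ l := by
  classical
  by_contra! hk
  have h1 : (Finset.univ : Finset α) ⊆ l.toFinset := fun k _ => List.mem_toFinset.2 (hk k)
  have h2 := (Finset.card_le_card h1).trans l.toFinset_card_le
  rw [Finset.card_univ] at h2
  omega

lemma exists_ne_notMem_list [Fintype α] (l : List α) (h : l.length + 1 < Fintype.card α) :
    ∃ k k', k ∉ l ∧ k' ∉ l ∧ k ≠ k' := by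
  obtain ⟨k, hk⟩ := exists_notMem_list l (by omega)
  obtain ⟨k', hk'⟩ := exists_notMem_list (k :: l) (by simpa using h)
  simp only [List.mem_cons, not_or] at hk'
  exact ⟨k, k', hk, hk'.2, fun h => hk'.1 h.symm⟩

/-- The edges `xa`, `ya`, `xb`, `yb` of a 4-cycle, with two colors available at `a` and at `b`. -/
lemma exists_four_cycle_colors {A B : Finset α} (hA : 2 ≤ A.card) (hB : 2 ≤ B.card) :
    ∃ p ∈ A, ∃ q ∈ A, ∃ r ∈ B, ∃ s ∈ B, p ≠ q ∧ r ≠ s ∧ p ≠ r ∧ q ≠ s := by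
  obtain ⟨p, hp, q, hq, hpq⟩ := Finset.one_lt_card.1 hA
  obtain ⟨r, hr, s, hs, hrs⟩ := Finset.one_lt_card.1 hB
  by_cases h : p ≠ r ∧ q ≠ s
  · exact ⟨p, hp, q, hq, r, hr, s, hs, hpq, hrs, h.1, h.2⟩
  · refine ⟨p, hp, q, hq, s, hs, r, hr, hpq, hrs.symm, ?_, ?_⟩ <;> grind

/-- Colors of two adjacent vertices `x`, `y` and of the edge `xy`, when `x` sees the edge colors
`p`, `r` and the vertex colors `c`, `d`, and `y` sees the edge colors `q`, `s` and the same vertex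
colors. -/
lemma exists_edge_colors [Fintype α] (h6 : 6 ≤ Fintype.card α) {p q r s c d : α}
    (hcp : c ≠ p) (hcq : c ≠ q) :
    ∃ x y z : α, x ≠ y ∧ x ≠ z ∧ y ≠ z ∧ x ∉ [p, r, c, d] ∧ y ∉ [q, s, c, d] ∧
      z ∉ [p, q, r, s] := by
  -- If `c` is `r` or `s`, it repeats an entry in one of the lists for `x` and `y`, so five
  -- exclusions suffice at that vertex and it can be colored last. Otherwise `c` itself is free for
  -- the edge `xy`, and only two colors remain to be chosen.
  by_cases hr : c = r
  · obtain ⟨z, hz⟩ := exists_notMem_list [p, q, r, s] (by simp; omega)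
    obtain ⟨y, hy⟩ := exists_notMem_list [q, s, c, d, z] (by simp; omega)
    obtain ⟨x, hx⟩ := exists_notMem_list [p, r, d, z, y] (by simp; omega)
    simp only [List.mem_cons, List.not_mem_nil, or_false, not_or] at hx hy hz
    exact ⟨x, y, z, by grind⟩
  by_cases hs : c = s
  · obtain ⟨z, hz⟩ := exists_notMem_list [p, q, r, s] (by simp; omega)
    obtain ⟨x, hx⟩ := exists_notMem_list [p, r, c, d, z] (by simp; omega)
    obtain ⟨y, hy⟩ := exists_notMem_list [q, s, d, z, x] (by simp; omega)
    simp only [List.mem_cons, List.not_mem_nil, or_false, not_or] at hx hy hz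
    exact ⟨x, y, z, by grind⟩
  · obtain ⟨x, hx⟩ := exists_notMem_list [p, r, c, d] (by simp; omega)
    obtain ⟨y, hy⟩ := exists_notMem_list [q, s, c, d, x] (by simp; omega)
    simp only [List.mem_cons, List.not_mem_nil, or_false, not_or] at hx hy
    exact ⟨x, y, c, by grind⟩

/-- Equality between two triples of distinct colors is a partial matching, and `K₃,₃` minus a
matching has a perfect matching. -/
lemma exists_disagreeing_triples {A B : Finset α} (hA : 3 ≤ A.card) (hB : 3 ≤ B.card) :
    ∃ p ∈ A, ∃ q ∈ A, ∃ r ∈ A, ∃ p' ∈ B, ∃ q' ∈ B, ∃ r' ∈ B, p ≠ q ∧ p ≠ r ∧ q ≠ r ∧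
      p' ≠ q' ∧ p' ≠ r' ∧ q' ≠ r' ∧ p ≠ p' ∧ q ≠ q' ∧ r ≠ r' := by
  obtain ⟨p, hp, q, hq, r, hr, h⟩ := Finset.two_lt_card.1 hA
  obtain ⟨u, hu, v, hv, w, hw, h'⟩ := Finset.two_lt_card.1 hB
  refine ⟨p, hp, q, hq, r, hr, ?_⟩
  by_cases h1 : p ≠ u ∧ q ≠ v ∧ r ≠ w
  · exact ⟨u, hu, v, hv, w, hw, by grind⟩
  by_cases h2 : p ≠ v ∧ q ≠ w ∧ r ≠ u
  · exact ⟨v, hv, w, hw, u, hu, by grind⟩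
  by_cases h3 : p ≠ w ∧ q ≠ u ∧ r ≠ v
  · exact ⟨w, hw, u, hu, v, hv, by grind⟩
  by_cases h4 : p ≠ u ∧ q ≠ w ∧ r ≠ v
  · exact ⟨u, hu, w, hw, v, hv, by grind⟩
  by_cases h5 : p ≠ v ∧ q ≠ u ∧ r ≠ w
  · exact ⟨v, hv, u, hu, w, hw, by grind⟩
  · exact ⟨w, hw, v, hv, u, hu, by grind⟩

/-- If `t` or `t'` is absent from its pair, that pair can be ordered freely to suit the other. If
both are present, then `q = t` and `m = t'` are forced, and these differ. -/
lemma exists_disagreeing_pairs {u v w s t t' : α} (huv : u ≠ v) (hws : w ≠ s) (ht : t ≠ t') :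
    ∃ p q r m : α, p ∈ [u, v] ∧ q ∈ [u, v] ∧ r ∈ [w, s] ∧ m ∈ [w, s] ∧ p ≠ q ∧ r ≠ m ∧
      p ≠ t ∧ r ≠ t' ∧ q ≠ m := by
  simp only [List.mem_cons, List.not_mem_nil, or_false]
  by_cases h1 : u ≠ t ∧ w ≠ t' ∧ v ≠ s
  · exact ⟨u, v, w, s, by grind⟩
  by_cases h2 : u ≠ t ∧ s ≠ t' ∧ v ≠ w
  · exact ⟨u, v, s, w, by grind⟩
  by_cases h3 : v ≠ t ∧ w ≠ t' ∧ u ≠ s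
  · exact ⟨v, u, w, s, by grind⟩
  · exact ⟨v, u, s, w, by grind⟩

/-- Colors for the edges and the inner vertices of a chain of triangles `a p x`, `x q y`, `y r b` on
the sides of the quadrangle `a x y b` with its diagonals, when `a` and `b` have the colors `c` and
`d`, the colors in `A` are available at `a`, and those in `B` are available at `b`. -/
lemma exists_chain_colors [Fintype α] (h6 : 6 ≤ Fintype.card α) {A B : Finset α} (hA : 3 ≤ A.card)
    (hB : 3 ≤ B.card) {c d : α} (hc : c ∉ A) :
    ∃ kap ∈ A, ∃ kax ∈ A, ∃ kay ∈ A, ∃ kbr ∈ B, ∃ kbx ∈ B, ∃ kby ∈ B,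
    ∃ kp kx kq ky kr kpx kqx kry kqy z : α,
      [kap, kax, kay].Nodup ∧ [kbr, kbx, kby].Nodup ∧ [kp, kap, kpx].Nodup ∧
      [kx, kax, kbx, kpx, kqx, z].Nodup ∧ [kq, kqx, kqy].Nodup ∧
      [ky, kay, kby, kry, kqy, z].Nodup ∧ [kr, kry, kbr].Nodup ∧ kp ≠ c ∧ kp ≠ kx ∧ kq ≠ kx ∧
      kq ≠ ky ∧ kr ≠ ky ∧ kr ≠ d ∧ kx ≠ ky ∧ kx ≠ c ∧ kx ≠ d ∧ ky ≠ c ∧ ky ≠ d := by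
  obtain ⟨kap, hkap, kax, hkax, kay, hkay, kbr, hkbr, kbx, hkbx, kby, hkby, a1, a2, a3, b1, b2, b3,
    c1, c2, c3⟩ := exists_disagreeing_triples hA hB
  obtain ⟨kx, ky, z, d1, d2, d3, hkx, hky, hz⟩ :=
    exists_edge_colors h6 (r := kbx) (s := kby) (c := c) (d := d)
      (fun h => hc (h ▸ hkax)) (fun h => hc (h ▸ hkay))
  -- Two colors are left at `x` for `xp` and `xq`, and two at `y` for `yr` and `yq`. The conflicts
  -- are with `ap` at `p`, with `br` at `r`, and between the two edges at `q`; this is where `kap ≠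
  -- kbr` is needed.
  obtain ⟨u, v, hu, hv, huv⟩ := exists_ne_notMem_list [kax, kbx, kx, z] (by simp; omega)
  obtain ⟨u', v', hu', hv', huv'⟩ := exists_ne_notMem_list [kay, kby, ky, z] (by simp; omega)
  obtain ⟨kpx, kqx, kry, kqy, m1, m2, m3, m4, e1, e2, e3, e4, e5⟩ :=
    exists_disagreeing_pairs huv huv' c1
  have hkpx : kpx ∉ [kax, kbx, kx, z] := by
    simp only [List.mem_cons, List.not_mem_nil, or_false] at m1
    rcases m1 with rfl | rfl <;> assumption
  have hkqx : kqx ∉ [kax, kbx, kx, z] := by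
    simp only [List.mem_cons, List.not_mem_nil, or_false] at m2
    rcases m2 with rfl | rfl <;> assumption
  have hkry : kry ∉ [kay, kby, ky, z] := by
    simp only [List.mem_cons, List.not_mem_nil, or_false] at m3
    rcases m3 with rfl | rfl <;> assumption
  have hkqy : kqy ∉ [kay, kby, ky, z] := by
    simp only [List.mem_cons, List.not_mem_nil, or_false] at m4
    rcases m4 with rfl | rfl <;> assumption
  obtain ⟨kp, hkp⟩ := exists_notMem_list [kap, kpx, c, kx] (by simp; omega)
  obtain ⟨kq, hkq⟩ := exists_notMem_list [kqx, kqy, kx, ky] (by simp; omega)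
  obtain ⟨kr, hkr⟩ := exists_notMem_list [kry, kbr, ky, d] (by simp; omega)
  clear m1 m2 m3 m4 hu hv hu' hv' huv huv'
  simp only [List.mem_cons, List.not_mem_nil, or_false, not_or] at hkx hky hz hkpx hkqx
  simp only [List.mem_cons, List.not_mem_nil, or_false, not_or] at hkry hkqy hkp hkq hkr
  refine ⟨kap, hkap, kax, hkax, kay, hkay, kbr, hkbr, kbx, hkbx, kby, hkby, kp, kx, kq, ky, kr,
    kpx, kqx, kry, kqy, z, ?_⟩
  simp only [List.nodup_cons, List.mem_cons, List.not_mem_nil, or_false, not_or, not_false_eq_true,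
    List.nodup_nil, and_true]
  grind

end ColorChoice

/-! ### Extending a partial total coloring -/

namespace SimpleGraph

variable {V α : Type*} {G : SimpleGraph V}

/-- A total coloring written as one function on unordered pairs: the color of the vertex `v` is the
value at `s(v, v)`. -/
def IsTotalColoring (G : SimpleGraph V) (T : Sym2 V → α) : Prop :=
  (∀ v w w', (w = v ∨ G.Adj v w) → (w' = v ∨ G.Adj v w') → w ≠ w' → T s(v, w) ≠ T s(v, w')) ∧
    ∀ u v, G.Adj u v → T s(u, u) ≠ T s(v, v)

def IsTotalColoring.toTotalColoring {T : Sym2 V → α} (h : G.IsTotalColoring T) :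
    G.TotalColoring α where
  vertexColor v := T s(v, v)
  edgeColor e := T e.1
  vertex_ne := h.2
  edge_ne := by
    rintro ⟨e, he⟩ ⟨f, hf⟩ hne v hve hvf
    obtain ⟨w, rfl⟩ := hve
    obtain ⟨w', rfl⟩ := hvf
    exact h.1 v w w' (Or.inr he) (Or.inr hf) fun hww => hne (by subst hww; rfl)
  incident_ne := by
    rintro v ⟨e, he⟩ hve
    obtain ⟨w, rfl⟩ := hve
    exact h.1 v v w (Or.inl rfl) (Or.inr he) (G.ne_of_adj he)

/-- The graph `G` without the edges at vertices of `X`. -/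
def isolate (G : SimpleGraph V) (X : Finset V) : SimpleGraph V where
  Adj u v := G.Adj u v ∧ u ∉ X ∧ v ∉ X
  symm := ⟨fun _ _ h => ⟨h.1.symm, h.2.2, h.2.1⟩⟩
  loopless := ⟨fun _ h => G.irrefl h.1⟩

lemma isolate_lt {X : Finset V} {x u : V} (hx : x ∈ X) (h : G.Adj x u) : G.isolate X < G :=
  lt_of_le_not_ge (fun _ _ h => h.1) fun hle => (hle h).2.1 hx

/-- Extending a total coloring to the vertices of `X` and the edges at them. -/
lemma IsTotalColoring.extend {X : Finset V} {T : Sym2 V → α} (hT : (G.isolate X).IsTotalColoring T)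
    (g : Sym2 V → α)
    (hrow : ∀ x ∈ X, ∀ w w', (w = x ∨ G.Adj x w) → (w' = x ∨ G.Adj x w') → w ≠ w' →
      g s(x, w) ≠ g s(x, w'))
    (hdiag : ∀ x ∈ X, ∀ y ∈ X, G.Adj x y → g s(x, x) ≠ g s(y, y))
    (hdiag' : ∀ x ∈ X, ∀ v ∉ X, G.Adj x v → g s(x, x) ≠ T s(v, v))
    (hside : ∀ x ∈ X, ∀ v ∉ X, G.Adj x v → ∀ w ∉ X, (w = v ∨ G.Adj v w) → g s(x, v) ≠ T s(v, w))
    (hside' : ∀ v ∉ X, ∀ x ∈ X, ∀ y ∈ X, G.Adj x v → G.Adj y v → x ≠ y → g s(x, v) ≠ g s(y, v)) :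
    ∃ T' : Sym2 V → α, G.IsTotalColoring T' := by
  classical
  set T' : Sym2 V → α := fun e => if ∃ x ∈ X, x ∈ e then g e else T e
  have hX : ∀ x ∈ X, ∀ w, T' s(x, w) = g s(x, w) := fun x hx w =>
    if_pos ⟨x, hx, Sym2.mem_mk_left _ _⟩
  have hX' : ∀ x ∈ X, ∀ w, T' s(w, x) = g s(x, w) := fun x hx w => by
    rw [Sym2.eq_swap, hX x hx]
  have hO : ∀ v ∉ X, ∀ w ∉ X, T' s(v, w) = T s(v, w) := fun v hv w hw => by
    refine if_neg ?_
    rintro ⟨x, hx, h⟩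
    rcases Sym2.mem_iff.1 h with rfl | rfl <;> contradiction
  refine ⟨T', fun v w w' hw hw' hne => ?_, fun u v huv => ?_⟩
  · by_cases hv : v ∈ X
    · rw [hX v hv, hX v hv]
      exact hrow v hv w w' hw hw' hne
    · have hwX : ∀ {w}, (w = v ∨ G.Adj v w) → w ∈ X → G.Adj w v := by
        rintro w (rfl | h) hwX
        · exact absurd hwX hv
        · exact h.symm
      by_cases h : w ∈ X <;> by_cases h' : w' ∈ X
      · rw [hX' w h, hX' w' h']
        exact hside' v hv w h w' h' (hwX hw h) (hwX hw' h') hne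
      · rw [hX' w h, hO v hv w' h']
        exact hside w h v hv (hwX hw h) w' h' hw'
      · rw [hX' w' h', hO v hv w h]
        exact (hside w' h' v hv (hwX hw' h') w h hw).symm
      · rw [hO v hv w h, hO v hv w' h']
        exact hT.1 v w w' (hw.imp_right fun hvw => ⟨hvw, hv, h⟩)
          (hw'.imp_right fun hvw => ⟨hvw, hv, h'⟩) hne
  · by_cases hu : u ∈ X <;> by_cases hv : v ∈ X
    · rw [hX u hu, hX v hv]
      exact hdiag u hu v hv huv
    · rw [hX u hu, hO v hv v hv]
      exact hdiag' u hu v hv huv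
    · rw [hX v hv, hO u hu u hu]
      exact (hdiag' v hv u hu huv.symm).symm
    · rw [hO u hu u hu, hO v hv v hv]
      exact hT.2 u v ⟨huv, hu, hv⟩

/-- The colors that do not occur at `a` on the part of the graph away from `X`. -/
lemma exists_available [Finite V] [Fintype α] (G : SimpleGraph V) (X Y : Finset V)
    (T : Sym2 V → α) (a : V) (hYX : Y ⊆ X) (hY : ∀ y ∈ Y, G.Adj a y) {m : ℕ}
    (hm : (G.neighborSet a).ncard + m + 1 ≤ Fintype.card α + Y.card) :
    ∃ A : Finset α, m ≤ A.card ∧ ∀ k ∈ A, ∀ w ∉ X, (w = a ∨ G.Adj a w) → k ≠ T s(a, w) := by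
  classical
  have := Fintype.ofFinite V
  set N : Finset V := Finset.univ.filter fun w => G.Adj a w ∧ w ∉ X
  refine ⟨((insert a N).image fun w => T s(a, w))ᶜ, ?_, ?_⟩
  · have h1 : ((insert a N).image fun w => T s(a, w)).card ≤ N.card + 1 :=
      Finset.card_image_le.trans (Finset.card_insert_le _ _)
    -- The neighbours in `Y` lie in `X`, so their edges to `a` are uncolored and exclude nothing.
    have h2 : N.card + Y.card ≤ (G.neighborSet a).ncard := by
      rw [← Finset.card_union_of_disjoint, ← Set.ncard_coe_finset]
      · apply Set.ncard_le_ncard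
        · intro w hw
          rw [Finset.mem_coe, Finset.mem_union] at hw
          rcases hw with hw | hw
          · exact (Finset.mem_filter.1 hw).2.1
          · exact hY w hw
        · exact Set.toFinite _
      · rw [Finset.disjoint_left]
        exact fun w hw hw' => (Finset.mem_filter.1 hw).2.2 (hYX hw')
    rw [Finset.card_compl]
    omega
  · rintro k hk w hwX hw rfl
    rw [Finset.mem_compl, Finset.mem_image] at hk
    refine hk ⟨w, ?_, rfl⟩
    rcases hw with rfl | hw
    · exact Finset.mem_insert_self _ _
    · exact Finset.mem_insert_of_mem (by simp [N, hw, hwX])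

end SimpleGraph

/-! ### Reducible configurations -/

namespace SimpleGraph

variable {V α : Type*} [Finite V] [Fintype α] {G : SimpleGraph V}

/-- A vertex with one neighbour, or with two neighbours one of which has degree at most `|α| - 2`,
is reducible. -/
lemma exists_isTotalColoring_of_degree_le_two (h6 : 6 ≤ Fintype.card α)
    (hdeg : ∀ v, (G.neighborSet v).ncard + 1 ≤ Fintype.card α)
    (ih : ∀ H < G, ∃ T : Sym2 V → α, H.IsTotalColoring T) {v a b : V} (hva : G.Adj v a)
    (hvb : G.Adj v b) (hN : ∀ w, G.Adj v w → w = a ∨ w = b)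
    (ha : a ≠ b → (G.neighborSet a).ncard + 2 ≤ Fintype.card α) :
    ∃ T : Sym2 V → α, G.IsTotalColoring T := by
  classical
  obtain ⟨T, hT⟩ := ih _ (isolate_lt (Finset.mem_singleton_self v) hva)
  obtain ⟨B, hB, hB'⟩ := exists_available G {v} {v} T b subset_rfl (m := 1)
    (by simpa using hvb.symm) (by have := hdeg b; simp; omega)
  have hav : a ≠ v := hva.ne'
  have hbv : b ≠ v := hvb.ne'
  obtain ⟨k', hk'⟩ := Finset.card_pos.1 hB
  replace hB' := hB' k' hk'
  -- The case `a = b` is that of a single neighbour. Otherwise the bound on the degree of `a` leaves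
  -- two colors there, one of which avoids `k'`.
  obtain ⟨k, hA', hkk'⟩ : ∃ k, (∀ w ∉ ({v} : Finset V), (w = a ∨ G.Adj a w) → k ≠ T s(a, w)) ∧
      (a ≠ b → k ≠ k') := by
    by_cases hab : a = b
    · subst hab
      exact ⟨k', hB', fun h => absurd rfl h⟩
    · obtain ⟨A, hA, hA'⟩ := exists_available G {v} {v} T a subset_rfl (m := 2)
        (by simpa using hva.symm) (by have := ha hab; simp; omega)
      obtain ⟨k, hk, hkk'⟩ := Finset.exists_mem_ne hA k'
      exact ⟨k, hA' k hk, fun _ => hkk'⟩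
  simp only [Finset.mem_singleton] at hA' hB'
  obtain ⟨c, hc⟩ := exists_notMem_list [k, k', T s(a, a), T s(b, b)] (by simp; omega)
  simp only [List.mem_cons, List.not_mem_nil, or_false, not_or] at hc
  obtain ⟨hc1, hc2, hc3, hc4⟩ := hc
  set g : Sym2 V → α := fun e => if e = s(v, v) then c else if e = s(v, a) then k else k'
  have g1 : g s(v, v) = c := by simp [g]
  have g2 : g s(v, a) = k := by simp [g, hav]
  have g3 : a ≠ b → g s(v, b) = k' := fun h => by simp [g, hbv, h.symm]
  refine hT.extend g ?_ ?_ ?_ ?_ ?_ <;> simp only [Finset.mem_singleton, forall_eq]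
  · intro w w' hw hw' hne
    by_cases hab : a = b
    · subst hab
      have hw := hw.imp_right (hN w)
      have hw' := hw'.imp_right (hN w')
      simp only [or_self] at hw hw'
      rcases hw with rfl | rfl <;> rcases hw' with rfl | rfl
      · contradiction
      · rw [g1, g2]; exact hc1
      · rw [g1, g2]; exact Ne.symm hc1
      · contradiction
    · have g3 := g3 hab
      have hkk' := hkk' hab
      rcases hw.imp_right (hN w) with rfl | rfl | rfl <;>
        rcases hw'.imp_right (hN w') with rfl | rfl | rfl <;>
        first | contradiction | (simp only [g1, g2, g3]; grind)
  · exact fun h => absurd h (G.irrefl)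
  · intro w _ hvw
    rw [g1]
    rcases hN w hvw with rfl | rfl
    exacts [hc3, hc4]
  · intro u _ hvu w hw huw
    rcases hN u hvu with rfl | rfl
    · rw [g2]; exact hA' w hw huw
    · by_cases hau : a = u
      · subst hau
        rw [g2]; exact hA' w hw huw
      · rw [g3 hau]; exact hB' w hw huw
  · exact fun _ _ _ _ h => absurd rfl h

/-- Two vertices `x`, `y`, possibly adjacent, whose other neighbours are `a` and `b`, are
reducible. -/
lemma exists_isTotalColoring_of_twins (h6 : 6 ≤ Fintype.card α)
    (hdeg : ∀ v, (G.neighborSet v).ncard + 1 ≤ Fintype.card α)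
    (ih : ∀ H < G, ∃ T : Sym2 V → α, H.IsTotalColoring T) {a b x y : V} (hab : a ≠ b) (hxy : x ≠ y)
    (hxa : G.Adj x a) (hxb : G.Adj x b) (hya : G.Adj y a) (hyb : G.Adj y b)
    (hNx : ∀ w, G.Adj x w → w = a ∨ w = b ∨ w = y)
    (hNy : ∀ w, G.Adj y w → w = a ∨ w = b ∨ w = x) :
    ∃ T : Sym2 V → α, G.IsTotalColoring T := by
  classical
  obtain ⟨T, hT⟩ := ih (G.isolate {x, y}) (isolate_lt (by simp) hxa)
  obtain ⟨A, hA, hA'⟩ := exists_available G {x, y} {x, y} T a subset_rfl (m := 2)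
    (by simp [hxa.symm, hya.symm]) (by have := hdeg a; rw [Finset.card_pair hxy]; omega)
  obtain ⟨B, hB, hB'⟩ := exists_available G {x, y} {x, y} T b subset_rfl (m := 2)
    (by simp [hxb.symm, hyb.symm]) (by have := hdeg b; rw [Finset.card_pair hxy]; omega)
  have hax : a ≠ x := hxa.ne'
  have hay : a ≠ y := hya.ne'
  have hbx : b ≠ x := hxb.ne'
  have hby : b ≠ y := hyb.ne'
  obtain ⟨p, hp, q, hq, r, hr, s, hs, hpq, hrs, hpr, hqs⟩ := exists_four_cycle_colors hA hB
  have haX : a ∉ ({x, y} : Finset V) := by simp [hax, hay]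
  have hbX : b ∉ ({x, y} : Finset V) := by simp [hbx, hby]
  obtain ⟨cx, cy, z, hcxy, hcxz, hcyz, hcx, hcy, hz⟩ :=
    exists_edge_colors h6 (r := r) (s := s) (d := T s(b, b)) (hA' p hp a haX (Or.inl rfl)).symm
      (hA' q hq a haX (Or.inl rfl)).symm
  simp only [List.mem_cons, List.not_mem_nil, or_false, not_or] at hcx hcy hz
  set g : Sym2 V → α := fun e => if e = s(x, x) then cx else if e = s(y, y) then cy else
    if e = s(x, y) then z else if e = s(x, a) then p else if e = s(y, a) then q else
    if e = s(x, b) then r else s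
  have gxx : g s(x, x) = cx := by simp [g]
  have gyy : g s(y, y) = cy := by simp [g, hxy.symm]
  have gxy : g s(x, y) = z := by simp [g, hxy, hxy.symm]
  have gyx : g s(y, x) = z := by rw [Sym2.eq_swap]; exact gxy
  have gxa : g s(x, a) = p := by simp [g, hax, hay, hxy]
  have gya : g s(y, a) = q := by simp [g, hax, hay, hxy.symm]
  have gxb : g s(x, b) = r := by simp [g, hbx, hby, hab.symm, hxy]
  have gyb : g s(y, b) = s := by simp [g, hbx, hby, hab.symm, hxy.symm]
  refine hT.extend g ?_ ?_ ?_ ?_ ?_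
  · intro u hu w w' hw hw' hne
    rcases Finset.mem_insert.1 hu with rfl | hu
    · rcases hw.imp_right (hNx w) with rfl | rfl | rfl | rfl <;>
        rcases hw'.imp_right (hNx w') with rfl | rfl | rfl | rfl <;>
        first | contradiction | (simp only [gxx, gxy, gxa, gxb]; grind)
    · rw [Finset.mem_singleton] at hu
      subst hu
      rcases hw.imp_right (hNy w) with rfl | rfl | rfl | rfl <;>
        rcases hw'.imp_right (hNy w') with rfl | rfl | rfl | rfl <;>
        first | contradiction | (simp only [gyy, gyx, gya, gyb]; grind)
  · simp only [Finset.mem_insert, Finset.mem_singleton]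
    rintro u (rfl | rfl) v (rfl | rfl) huv
    · exact absurd huv G.irrefl
    · rw [gxx, gyy]; exact hcxy
    · rw [gxx, gyy]; exact hcxy.symm
    · exact absurd huv G.irrefl
  · simp only [Finset.mem_insert, Finset.mem_singleton, not_or]
    rintro u (rfl | rfl) v hv huv
    · rcases hNx v huv with rfl | rfl | rfl
      · rw [gxx]; exact hcx.2.2.1
      · rw [gxx]; exact hcx.2.2.2
      · exact absurd rfl hv.2
    · rcases hNy v huv with rfl | rfl | rfl
      · rw [gyy]; exact hcy.2.2.1
      · rw [gyy]; exact hcy.2.2.2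
      · exact absurd rfl hv.1
  · intro u hu v hv huv w hw hvw
    rcases Finset.mem_insert.1 hu with rfl | hu
    · rcases hNx v huv with rfl | rfl | rfl
      · rw [gxa]; exact hA' p hp w hw hvw
      · rw [gxb]; exact hB' r hr w hw hvw
      · simp at hv
    · rw [Finset.mem_singleton] at hu
      subst hu
      rcases hNy v huv with rfl | rfl | rfl
      · rw [gya]; exact hA' q hq w hw hvw
      · rw [gyb]; exact hB' s hs w hw hvw
      · simp at hv
  · have key : ∀ v ∉ ({x, y} : Finset V), G.Adj x v → g s(x, v) ≠ g s(y, v) := by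
      intro v hv hxv
      rcases hNx v hxv with rfl | rfl | rfl
      · rw [gxa, gya]; exact hpq
      · rw [gxb, gyb]; exact hrs
      · simp at hv
    intro v hv
    simp only [Finset.mem_insert, Finset.mem_singleton]
    rintro u (rfl | rfl) w (rfl | rfl) huv hwv hne
    · contradiction
    · exact key v hv huv
    · exact (key v hv hwv).symm
    · contradiction

/-- The chain of triangles `a p x`, `x q y`, `y r b` on the sides of the quadrangle `a x y b` with
its two diagonals is reducible. -/
lemma exists_isTotalColoring_of_chain (h6 : 6 ≤ Fintype.card α)
    (hdeg : ∀ v, (G.neighborSet v).ncard + 1 ≤ Fintype.card α)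
    (ih : ∀ H < G, ∃ T : Sym2 V → α, H.IsTotalColoring T) {a p x q y r b : V}
    (hnd : [a, p, x, q, y, r, b].Nodup)
    (hpa : G.Adj p a) (hxa : G.Adj x a) (hya : G.Adj y a)
    (hxb : G.Adj x b) (hyb : G.Adj y b) (hrb : G.Adj r b)
    (hNp : ∀ w, G.Adj p w → w = a ∨ w = x) (hNq : ∀ w, G.Adj q w → w = x ∨ w = y)
    (hNr : ∀ w, G.Adj r w → w = y ∨ w = b)
    (hNx : ∀ w, G.Adj x w → w = a ∨ w = b ∨ w = p ∨ w = q ∨ w = y)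
    (hNy : ∀ w, G.Adj y w → w = a ∨ w = b ∨ w = r ∨ w = q ∨ w = x) :
    ∃ T : Sym2 V → α, G.IsTotalColoring T := by
  classical
  simp only [List.nodup_cons, List.mem_cons, List.not_mem_nil, or_false, not_or, not_false_eq_true,
    List.nodup_nil, and_true] at hnd
  obtain ⟨⟨hap, hax, haq, hay, har, hab⟩, ⟨hpx, hpq, hpy, hpr, hpb⟩, ⟨hxq, hxy, hxr, hxb'⟩,
    ⟨hqy, hqr, hqb⟩, ⟨hyr, hyb'⟩, hrb'⟩ := hnd
  set X : Finset V := {p, x, q, y, r} with hX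
  obtain ⟨T, hT⟩ := ih (G.isolate X) (isolate_lt (x := p) (by simp [hX]) hpa)
  have haX : a ∉ X := by simp [*]
  have hbX : b ∉ X := by simp [Ne.symm, *, eq_comm (a := b)]
  obtain ⟨A, hA, hA'⟩ := exists_available G X {p, x, y} T a
    (by intro w; simp only [hX, Finset.mem_insert, Finset.mem_singleton]; tauto) (m := 3)
    (by simp [hpa.symm, hxa.symm, hya.symm])
    (by have := hdeg a; rw [Finset.card_eq_three.2 ⟨p, x, y, hpx, hpy, hxy, rfl⟩]; omega)
  obtain ⟨B, hB, hB'⟩ := exists_available G X {r, x, y} T b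
    (by intro w; simp only [hX, Finset.mem_insert, Finset.mem_singleton]; tauto) (m := 3)
    (by simp [hrb.symm, hxb.symm, hyb.symm])
    (by
      have := hdeg b
      rw [Finset.card_eq_three.2 ⟨r, x, y, Ne.symm hxr, Ne.symm hyr, hxy, rfl⟩]; omega)
  obtain ⟨kap, hkap, kax, hkax, kay, hkay, kbr, hkbr, kbx, hkbx, kby, hkby, kp, kx, kq, ky, kr, kpx,
    kqx, kry, kqy, z, hca, hcb, hcp, hcx, hcq, hcy, hcr, e1, e2, e3, e4, e5, e6, e7, e8, e9, e10,
    e11⟩ := exists_chain_colors h6 hA hB (c := T s(a, a)) (d := T s(b, b))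
    fun h => hA' _ h a haX (Or.inl rfl) rfl
  obtain ⟨g, gpp, gqq, grr, gxx, gyy, gpa, gxa, gya, gxb, gyb, grb, gpx, gqx, gqy, gry, gxy⟩ :
      ∃ g : Sym2 V → α, g s(p, p) = kp ∧ g s(q, q) = kq ∧ g s(r, r) = kr ∧ g s(x, x) = kx ∧
        g s(y, y) = ky ∧ g s(p, a) = kap ∧ g s(x, a) = kax ∧ g s(y, a) = kay ∧
        g s(x, b) = kbx ∧ g s(y, b) = kby ∧ g s(r, b) = kbr ∧ g s(p, x) = kpx ∧ g s(q, x) = kqx ∧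
        g s(q, y) = kqy ∧ g s(r, y) = kry ∧ g s(x, y) = z := by
    refine ⟨fun e => if e = s(p, p) then kp else if e = s(q, q) then kq else
      if e = s(r, r) then kr else if e = s(x, x) then kx else if e = s(y, y) then ky else
      if e = s(p, a) then kap else if e = s(x, a) then kax else if e = s(y, a) then kay else
      if e = s(x, b) then kbx else if e = s(y, b) then kby else if e = s(r, b) then kbr else
      if e = s(p, x) then kpx else if e = s(q, x) then kqx else if e = s(q, y) then kqy else
      if e = s(r, y) then kry else z, ?_⟩
    simp only [Sym2.eq_iff, and_true, and_self, or_self, if_true, if_false, and_false,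
      hap, hax, haq, hay, har, hab, hpx, hpq, hpy, hpr, hpb, hxq, hxy, hxr, hxb', hqy, hqr, hqb,
      hyr, hyb', hrb', Ne.symm hap, Ne.symm hax, Ne.symm haq, Ne.symm hay, Ne.symm har,
      Ne.symm hab, Ne.symm hpx, Ne.symm hpq, Ne.symm hpy, Ne.symm hpr, Ne.symm hpb, Ne.symm hxq,
      Ne.symm hxy, Ne.symm hxr, Ne.symm hxb', Ne.symm hqy, Ne.symm hqr, Ne.symm hqb, Ne.symm hyr,
      Ne.symm hyb', Ne.symm hrb']
  have gxp : g s(x, p) = kpx := by rw [Sym2.eq_swap]; exact gpx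
  have gxq : g s(x, q) = kqx := by rw [Sym2.eq_swap]; exact gqx
  have gyq : g s(y, q) = kqy := by rw [Sym2.eq_swap]; exact gqy
  have gyr : g s(y, r) = kry := by rw [Sym2.eq_swap]; exact gry
  have gyx : g s(y, x) = z := by rw [Sym2.eq_swap]; exact gxy
  have memX : ∀ {u}, u ∈ X → u = p ∨ u = x ∨ u = q ∨ u = y ∨ u = r := by
    intro u hu
    simpa only [hX, Finset.mem_insert, Finset.mem_singleton] using hu
  have nbrX : ∀ {u v}, u ∈ X → v ∉ X → G.Adj u v →
      (v = a ∧ (u = p ∨ u = x ∨ u = y)) ∨ (v = b ∧ (u = r ∨ u = x ∨ u = y)) := by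
    intro u v hu hv huv
    have hv' : v ≠ p ∧ v ≠ x ∧ v ≠ q ∧ v ≠ y ∧ v ≠ r := by
      simpa only [hX, Finset.mem_insert, Finset.mem_singleton, not_or] using hv
    rcases memX hu with rfl | rfl | rfl | rfl | rfl
    · rcases hNp v huv with rfl | rfl
      · exact Or.inl ⟨rfl, Or.inl rfl⟩
      · exact absurd rfl hv'.2.1
    · rcases hNx v huv with rfl | rfl | rfl | rfl | rfl
      · exact Or.inl ⟨rfl, Or.inr (Or.inl rfl)⟩
      · exact Or.inr ⟨rfl, Or.inr (Or.inl rfl)⟩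
      · exact absurd rfl hv'.1
      · exact absurd rfl hv'.2.2.1
      · exact absurd rfl hv'.2.2.2.1
    · rcases hNq v huv with rfl | rfl
      · exact absurd rfl hv'.2.1
      · exact absurd rfl hv'.2.2.2.1
    · rcases hNy v huv with rfl | rfl | rfl | rfl | rfl
      · exact Or.inl ⟨rfl, Or.inr (Or.inr rfl)⟩
      · exact Or.inr ⟨rfl, Or.inr (Or.inr rfl)⟩
      · exact absurd rfl hv'.2.2.2.2
      · exact absurd rfl hv'.2.2.1
      · exact absurd rfl hv'.2.1
    · rcases hNr v huv with rfl | rfl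
      · exact absurd rfl hv'.2.2.2.1
      · exact Or.inr ⟨rfl, Or.inl rfl⟩
  have row : ∀ (u : V) (L : List V), (∀ w, (w = u ∨ G.Adj u w) → w ∈ L) →
      (L.map fun w => g s(u, w)).Nodup → ∀ w w', (w = u ∨ G.Adj u w) → (w' = u ∨ G.Adj u w') →
      w ≠ w' → g s(u, w) ≠ g s(u, w') := fun u L hL hnd w w' hw hw' hne h =>
    hne (List.inj_on_of_nodup_map hnd (hL w hw) (hL w' hw') h)
  refine hT.extend g ?_ ?_ ?_ ?_ ?_
  · intro u hu
    rcases memX hu with rfl | rfl | rfl | rfl | rfl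
    · refine row _ [u, a, x] (fun w hw => ?_) (by simpa only [List.map, gpp, gpa, gpx] using hcp)
      simpa using hw.imp_right (hNp w)
    · refine row _ [u, a, b, p, q, y] (fun w hw => ?_)
        (by simpa only [List.map, gxx, gxa, gxb, gxp, gxq, gxy] using hcx)
      simpa using hw.imp_right (hNx w)
    · refine row _ [u, x, y] (fun w hw => ?_) (by simpa only [List.map, gqq, gqx, gqy] using hcq)
      simpa using hw.imp_right (hNq w)
    · refine row _ [u, a, b, r, q, x] (fun w hw => ?_)
        (by simpa only [List.map, gyy, gya, gyb, gyr, gyq, gyx] using hcy)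
      simpa using hw.imp_right (hNy w)
    · refine row _ [u, y, b] (fun w hw => ?_) (by simpa only [List.map, grr, gry, grb] using hcr)
      simpa using hw.imp_right (hNr w)
  · intro u hu v hv huv
    rcases memX hu with rfl | rfl | rfl | rfl | rfl
    · rcases hNp v huv with rfl | rfl
      · contradiction
      · rw [gpp, gxx]; assumption
    · rcases hNx v huv with rfl | rfl | rfl | rfl | rfl
      · contradiction
      · contradiction
      · rw [gpp, gxx]; apply Ne.symm; assumption
      · rw [gqq, gxx]; apply Ne.symm; assumption
      · rw [gyy, gxx]; assumption
    · rcases hNq v huv with rfl | rfl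
      · rw [gqq, gxx]; assumption
      · rw [gqq, gyy]; assumption
    · rcases hNy v huv with rfl | rfl | rfl | rfl | rfl
      · contradiction
      · contradiction
      · rw [grr, gyy]; apply Ne.symm; assumption
      · rw [gqq, gyy]; apply Ne.symm; assumption
      · rw [gyy, gxx]; apply Ne.symm; assumption
    · rcases hNr v huv with rfl | rfl
      · rw [grr, gyy]; assumption
      · contradiction
  · intro u hu v hv huv
    rcases nbrX hu hv huv with ⟨rfl, rfl | rfl | rfl⟩ | ⟨rfl, rfl | rfl | rfl⟩
    · rw [gpp]; assumption
    · rw [gxx]; assumption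
    · rw [gyy]; assumption
    · rw [grr]; assumption
    · rw [gxx]; assumption
    · rw [gyy]; assumption
  · intro u hu v hv huv w hw hvw
    rcases nbrX hu hv huv with ⟨rfl, rfl | rfl | rfl⟩ | ⟨rfl, rfl | rfl | rfl⟩
    · rw [gpa]; exact hA' _ hkap w hw hvw
    · rw [gxa]; exact hA' _ hkax w hw hvw
    · rw [gya]; exact hA' _ hkay w hw hvw
    · rw [grb]; exact hB' _ hkbr w hw hvw
    · rw [gxb]; exact hB' _ hkbx w hw hvw
    · rw [gyb]; exact hB' _ hkby w hw hvw
  · intro v hv u hu w hw huv hwv hne heq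
    rcases nbrX hu hv huv with ⟨rfl, hu⟩ | ⟨rfl, hu⟩
    · rcases nbrX hw hv hwv with ⟨-, hw⟩ | ⟨h, -⟩
      · have hnd : ([p, x, y].map fun w => g s(w, v)).Nodup := by
          simpa only [List.map, gpa, gxa, gya] using hca
        exact hne (List.inj_on_of_nodup_map hnd (by simpa using hu) (by simpa using hw) heq)
      · contradiction
    · rcases nbrX hw hv hwv with ⟨h, -⟩ | ⟨-, hw⟩
      · exact absurd h.symm hab
      · have hnd : ([r, x, y].map fun w => g s(w, v)).Nodup := by
          simpa only [List.map, grb, gxb, gyb] using hcb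
        exact hne (List.inj_on_of_nodup_map hnd (by simpa using hu) (by simpa using hw) heq)

end SimpleGraph

/-! ### Unavoidable configurations -/

namespace SimpleGraph

variable {V : Type*} {G : SimpleGraph V}

lemma ncard_neighborSet_le_length {v : V} (L : List V) (h : ∀ w, G.Adj v w → w ∈ L) :
    (G.neighborSet v).ncard ≤ L.length := by
  classical
  calc (G.neighborSet v).ncard ≤ (L.toFinset : Set V).ncard :=
        Set.ncard_le_ncard (fun w hw => by simpa using h w hw) (Finset.finite_toSet _)
    _ ≤ L.length := by rw [Set.ncard_coe_finset]; exact L.toFinset_card_le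

/-- A vertex with at most two neighbours has two of them, and their degrees are at least five. -/
def SmallDegreeCondition (G : SimpleGraph V) : Prop :=
  ∀ v a b, G.Adj v a → G.Adj v b → (∀ w, G.Adj v w → w = a ∨ w = b) →
    a ≠ b ∧ 5 ≤ (G.neighborSet a).ncard

/-- A vertex with only one neighbour would contradict the condition, taken with that neighbour as
both `a` and `b`. -/
lemma SmallDegreeCondition.adj {v a b : V} (h : G.SmallDegreeCondition) (hv : ∃ w, G.Adj v w)
    (hN : ∀ w, G.Adj v w → w = a ∨ w = b) :
    G.Adj v a ∧ G.Adj v b ∧ 5 ≤ (G.neighborSet a).ncard ∧ 5 ≤ (G.neighborSet b).ncard := by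
  obtain ⟨w, hw⟩ := hv
  by_cases ha : G.Adj v a
  · by_cases hb : G.Adj v b
    · exact ⟨ha, hb, (h v a b ha hb hN).2, (h v b a hb ha fun w hw => (hN w hw).symm).2⟩
    · refine absurd rfl (h v a a ha ha fun w hw => ?_).1
      rcases hN w hw with rfl | rfl
      exacts [Or.inl rfl, absurd hw hb]
  · have hb : G.Adj v b := by
      rcases hN w hw with rfl | rfl
      exacts [absurd hw ha, hw]
    refine absurd rfl (h v b b hb hb fun w hw => ?_).1
    rcases hN w hw with rfl | rfl
    exacts [absurd hw ha, Or.inl rfl]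

/-- Two vertices `x`, `y`, possibly adjacent, whose other neighbours are `a` and `b`. -/
def HasTwins (G : SimpleGraph V) : Prop :=
  ∃ a b x y, a ≠ b ∧ x ≠ y ∧ G.Adj x a ∧ G.Adj x b ∧ G.Adj y a ∧ G.Adj y b ∧
    (∀ w, G.Adj x w → w = a ∨ w = b ∨ w = y) ∧ ∀ w, G.Adj y w → w = a ∨ w = b ∨ w = x

/-- Triangles `a p x`, `x q y`, `y r b` on the sides of the quadrangle `a x y b` with its two
diagonals, without further edges at the inner vertices. -/
def HasChain (G : SimpleGraph V) : Prop :=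
  ∃ a p x q y r b, [a, p, x, q, y, r, b].Nodup ∧ G.Adj p a ∧ G.Adj x a ∧ G.Adj y a ∧
    G.Adj x b ∧ G.Adj y b ∧ G.Adj r b ∧ (∀ w, G.Adj p w → w = a ∨ w = x) ∧
    (∀ w, G.Adj q w → w = x ∨ w = y) ∧ (∀ w, G.Adj r w → w = y ∨ w = b) ∧
    (∀ w, G.Adj x w → w = a ∨ w = b ∨ w = p ∨ w = q ∨ w = y) ∧
    ∀ w, G.Adj y w → w = a ∨ w = b ∨ w = r ∨ w = q ∨ w = x

variable [LinearOrder V]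

/-- No edge of `G` crosses the chord `ab`. -/
def Uncrossed (G : SimpleGraph V) (a b : V) : Prop :=
  ∀ u v, G.Adj u v → u ∈ Set.Ioo a b → v ∈ Set.Icc a b

/-- The non-isolated vertices strictly between `a` and `b`. -/
def inner (G : SimpleGraph V) (a b : V) : Set V :=
  {v | a < v ∧ v < b ∧ ∃ w, G.Adj v w}

/-- Every edge, drawn as a chord, crosses at most one other edge. -/
def CrossesAtMostOnce (G : SimpleGraph V) : Prop :=
  ∀ a c b d b' d', G.Adj a c → G.Adj b d → G.Adj b' d' → Interleave a c b d →
    Interleave a c b' d' → b = b' ∧ d = d'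

lemma SmallDegreeCondition.inner_eq [Finite V] {a b : V} (h : G.SmallDegreeCondition)
    (hab : G.Uncrossed a b) (hI : (G.inner a b).ncard ≤ 1) :
    G.inner a b = ∅ ∨ ∃ x, G.inner a b = {x} ∧ a < x ∧ x < b ∧ G.Adj x a ∧ G.Adj x b ∧
      (∀ w, G.Adj x w → w = a ∨ w = b) ∧ 5 ≤ (G.neighborSet a).ncard ∧
      5 ≤ (G.neighborSet b).ncard := by
  rcases Nat.le_one_iff_eq_zero_or_eq_one.1 hI with h0 | h1
  · exact Or.inl ((Set.ncard_eq_zero).1 h0)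
  · right
    obtain ⟨x, hx⟩ := Set.ncard_eq_one.1 h1
    obtain ⟨hax, hxb, hadj⟩ : x ∈ G.inner a b := hx ▸ rfl
    have hN : ∀ w, G.Adj x w → w = a ∨ w = b := by
      intro w hw
      obtain ⟨haw, hwb⟩ := hab x w hw ⟨hax, hxb⟩
      by_contra! hne
      have : w ∈ G.inner a b := ⟨lt_of_le_of_ne haw hne.1.symm, lt_of_le_of_ne hwb hne.2, x, hw.symm⟩
      rw [hx] at this
      exact G.ne_of_adj hw this.symm
    obtain ⟨h1, h2, h3, h4⟩ := h.adj hadj hN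
    exact ⟨x, hx, hax, hxb, h1, h2, hN, h3, h4⟩

/-- By minimality the chords `ac` and `cb` span at most one non-isolated vertex each, so `c` has at
most four neighbours. But a vertex spanned by either chord forces degree five at `c`, and with none
`c` would be alone inside `ab`. -/
lemma SmallDegreeCondition.not_uncrossed_triangle [Finite V] {a b c : V}
    (h : G.SmallDegreeCondition) (hab : G.Uncrossed a b) (h2 : 2 ≤ (G.inner a b).ncard)
    (hmin : ∀ u v, G.Uncrossed u v → G.inner u v ⊂ G.inner a b → (G.inner u v).ncard ≤ 1)
    (hc : c ∈ G.inner a b) (hac : G.Uncrossed a c) (hcb : G.Uncrossed c b) : False := by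
  obtain ⟨hac', hcb', hc'⟩ := hc
  have hN : ∀ w, G.Adj c w → w = a ∨ w = b ∨ w ∈ G.inner a c ∨ w ∈ G.inner c b := by
    intro w hw
    obtain ⟨h1, h2⟩ := hab c w hw ⟨hac', hcb'⟩
    rcases h1.eq_or_lt with rfl | h1
    · exact Or.inl rfl
    rcases h2.eq_or_lt with rfl | h2
    · exact Or.inr (Or.inl rfl)
    rcases lt_or_gt_of_ne (G.ne_of_adj hw) with h3 | h3
    · exact Or.inr (Or.inr (Or.inr ⟨h3, h2, c, hw.symm⟩))
    · exact Or.inr (Or.inr (Or.inl ⟨h1, h3, c, hw.symm⟩))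
  have s1 : G.inner a c ⊂ G.inner a b :=
    ⟨fun w hw => ⟨hw.1, hw.2.1.trans hcb', hw.2.2⟩,
      fun hs => lt_irrefl _ (hs ⟨hac', hcb', hc'⟩).2.1⟩
  have s2 : G.inner c b ⊂ G.inner a b :=
    ⟨fun w hw => ⟨hac'.trans hw.1, hw.2.1, hw.2.2⟩,
      fun hs => lt_irrefl _ (hs ⟨hac', hcb', hc'⟩).1⟩
  rcases h.inner_eq hac (hmin a c hac s1) with e1 | ⟨x, e1, -, -, -, -, -, -, h5⟩ <;>
    rcases h.inner_eq hcb (hmin c b hcb s2) with e2 | ⟨y, e2, -, -, -, -, -, h5', -⟩ <;>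
    rw [e1, e2] at hN
  · have : G.inner a b ⊆ {c} := by
      intro w hw
      by_contra hne
      rcases lt_or_gt_of_ne hne with h3 | h3
      · have : w ∈ G.inner a c := ⟨hw.1, h3, hw.2.2⟩
        simp [e1] at this
      · have : w ∈ G.inner c b := ⟨h3, hw.2.1, hw.2.2⟩
        simp [e2] at this
    have := Set.ncard_le_ncard this
    rw [Set.ncard_singleton] at this
    omega
  · have := ncard_neighborSet_le_length [a, b, y] fun w hw => by simpa using hN w hw
    simp at this
    omega
  · have := ncard_neighborSet_le_length [a, b, x] fun w hw => by simpa using hN w hw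
    simp at this
    omega
  · have := ncard_neighborSet_le_length [a, b, x, y] fun w hw => by simpa using hN w hw
    simp at this
    omega

/-- Without a crossing, the last inner neighbour `c` of `a`, or the first inner vertex if `a` has no
inner neighbour, makes both `ac` and `cb` uncrossed. -/
lemma SmallDegreeCondition.exists_crossing [Finite V] {a b : V}
    (h : G.SmallDegreeCondition) (hab : G.Uncrossed a b) (h2 : 2 ≤ (G.inner a b).ncard)
    (hmin : ∀ u v, G.Uncrossed u v → G.inner u v ⊂ G.inner a b → (G.inner u v).ncard ≤ 1) :
    ∃ u v w z, a ≤ u ∧ u < v ∧ v < w ∧ w < z ∧ z ≤ b ∧ G.Adj u w ∧ G.Adj v z := by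
  by_contra! hcon
  have hne : (G.inner a b).Nonempty := Set.nonempty_of_ncard_ne_zero (by omega)
  by_cases hN : {c ∈ G.inner a b | G.Adj a c}.Nonempty
  · obtain ⟨c, ⟨hc, hac⟩, hmax⟩ := Set.exists_max_image _ id (Set.toFinite _) hN
    refine h.not_uncrossed_triangle hab h2 hmin hc ?_ ?_
    · intro s t hst hs
      obtain ⟨h3, h4⟩ := hab s t hst ⟨hs.1, hs.2.trans hc.2.1⟩
      refine ⟨h3, not_lt.1 fun hct => hcon a s c t le_rfl hs.1 hs.2 hct h4 hac hst⟩
    · intro s t hst hs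
      obtain ⟨h3, h4⟩ := hab s t hst ⟨hc.1.trans hs.1, hs.2⟩
      refine ⟨not_lt.1 fun htc => ?_, h4⟩
      rcases h3.eq_or_lt with rfl | h3
      · exact not_lt.2 (hmax s ⟨⟨hc.1.trans hs.1, hs.2, _, hst⟩, hst.symm⟩) hs.1
      · exact hcon a t c s le_rfl h3 htc hs.1 hs.2.le hac hst.symm
  · obtain ⟨c, hc, hminc⟩ := Set.exists_min_image _ id (Set.toFinite _) hne
    refine h.not_uncrossed_triangle hab h2 hmin hc ?_ ?_
    · intro s t hst hs
      exact absurd (hminc s ⟨hs.1, hs.2.trans hc.2.1, t, hst⟩) (not_le.2 hs.2)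
    · intro s t hst hs
      have hs' : s ∈ G.inner a b := ⟨hc.1.trans hs.1, hs.2, t, hst⟩
      obtain ⟨h3, h4⟩ := hab s t hst ⟨hc.1.trans hs.1, hs.2⟩
      refine ⟨not_lt.1 fun htc => ?_, h4⟩
      rcases h3.eq_or_lt with rfl | h3
      · exact hN ⟨s, hs', hst.symm⟩
      · exact absurd (hminc t ⟨h3, htc.trans hc.2.1, s, hst.symm⟩) (not_le.2 htc)

section Crossing

variable {u v w z : V}

lemma CrossesAtMostOnce.eq_left (hG : G.CrossesAtMostOnce) (huv : u < v) (hvw : v < w)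
    (hwz : w < z) (huw : G.Adj u w) (hvz : G.Adj v z) {s t : V} (hst : G.Adj s t)
    (h : Interleave u w s t) : s = v ∧ t = z :=
  hG u w s t v z huw hst hvz h (Or.inl ⟨huv, hvw, hwz⟩)

lemma CrossesAtMostOnce.eq_right (hG : G.CrossesAtMostOnce) (huv : u < v) (hvw : v < w)
    (hwz : w < z) (huw : G.Adj u w) (hvz : G.Adj v z) {s t : V} (hst : G.Adj s t)
    (h : Interleave v z s t) : s = u ∧ t = w :=
  hG v z s t u w hvz hst huw h (Or.inr ⟨huv, hvw, hwz⟩)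

/-- An edge crossing a side of the quadrangle also crosses one of the diagonals `uw`, `vz`. These
already cross each other, so the edge would be the other diagonal, which crosses no side. -/
lemma CrossesAtMostOnce.uncrossed (hG : G.CrossesAtMostOnce) (huv : u < v) (hvw : v < w)
    (hwz : w < z) (huw : G.Adj u w) (hvz : G.Adj v z) :
    G.Uncrossed u z ∧ G.Uncrossed u v ∧ G.Uncrossed v w ∧ G.Uncrossed w z := by
  have L := fun {s t} => hG.eq_left huv hvw hwz huw hvz (s := s) (t := t)
  have R := fun {s t} => hG.eq_right huv hvw hwz huw hvz (s := s) (t := t)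
  have huz : G.Uncrossed u z := by
    rintro s t hst ⟨h1, h2⟩
    constructor
    · by_contra! ht
      rcases lt_or_ge s w with h3 | h3
      · have := (L hst.symm (Or.inr ⟨ht, h1, h3⟩)).1
        exact lt_asymm huv (this ▸ ht)
      · have := (R hst.symm (Or.inr ⟨ht.trans huv, hvw.trans_le h3, h2⟩)).1
        exact ht.ne this
    · by_contra! ht
      rcases lt_or_ge v s with h3 | h3
      · have := (R hst (Or.inl ⟨h3, h2, ht⟩)).1
        exact h1.ne' this
      · have := (L hst (Or.inl ⟨h1, h3.trans_lt hvw, hwz.trans ht⟩)).2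
        exact ht.ne' this
  refine ⟨huz, ?_, ?_, ?_⟩
  · rintro s t hst ⟨h1, h2⟩
    have h3 := huz s t hst ⟨h1, h2.trans (hvw.trans hwz)⟩
    refine ⟨h3.1, not_lt.1 fun ht => ?_⟩
    rcases lt_or_ge w t with h4 | h4
    · exact h2.ne (L hst (Or.inl ⟨h1, h2.trans hvw, h4⟩)).1
    · exact h1.ne' (R hst (Or.inr ⟨h2, ht, h4.trans_lt hwz⟩)).1
  · rintro s t hst ⟨h1, h2⟩
    constructor
    · by_contra! ht
      exact h2.ne (R hst.symm (Or.inr ⟨ht, h1, h2.trans hwz⟩)).2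
    · by_contra! ht
      exact h1.ne' (L hst (Or.inl ⟨huv.trans h1, h2, ht⟩)).1
  · rintro s t hst ⟨h1, h2⟩
    have h3 := huz s t hst ⟨(huv.trans hvw).trans h1, h2⟩
    refine ⟨not_lt.1 fun ht => ?_, h3.2⟩
    rcases lt_or_ge t v with h4 | h4
    · exact h1.ne' (R hst.symm (Or.inr ⟨h4, hvw.trans h1, h2⟩)).2
    · exact h2.ne (L hst.symm (Or.inl ⟨huv.trans_le h4, ht, h1⟩)).2

lemma CrossesAtMostOnce.neighbors (hG : G.CrossesAtMostOnce) (huv : u < v) (hvw : v < w)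
    (hwz : w < z) (huw : G.Adj u w) (hvz : G.Adj v z) :
    (∀ t, G.Adj v t → t = u ∨ t = z ∨ t ∈ G.inner u v ∨ t ∈ G.inner v w ∨ t = w) ∧
    (∀ t, G.Adj w t → t = u ∨ t = z ∨ t ∈ G.inner w z ∨ t ∈ G.inner v w ∨ t = v) := by
  obtain ⟨huz, -, -, -⟩ := hG.uncrossed huv hvw hwz huw hvz
  constructor
  · intro t ht
    obtain ⟨h1, h2⟩ := huz v t ht ⟨huv, hvw.trans hwz⟩
    rcases h1.eq_or_lt with rfl | h1
    · exact Or.inl rfl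
    rcases lt_trichotomy t w with h3 | h3 | h3
    · rcases lt_or_gt_of_ne (G.ne_of_adj ht) with h4 | h4
      · exact Or.inr (Or.inr (Or.inr (Or.inl ⟨h4, h3, v, ht.symm⟩)))
      · exact Or.inr (Or.inr (Or.inl ⟨h1, h4, v, ht.symm⟩))
    · exact Or.inr (Or.inr (Or.inr (Or.inr h3)))
    · exact Or.inr (Or.inl (hG.eq_left huv hvw hwz huw hvz ht (Or.inl ⟨huv, hvw, h3⟩)).2)
  · intro t ht
    obtain ⟨h1, h2⟩ := huz w t ht ⟨huv.trans hvw, hwz⟩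
    rcases h2.eq_or_lt with rfl | h2
    · exact Or.inr (Or.inl rfl)
    rcases lt_trichotomy t v with h3 | h3 | h3
    · exact Or.inl (hG.eq_right huv hvw hwz huw hvz ht.symm (Or.inr ⟨h3, hvw, hwz⟩)).1
    · exact Or.inr (Or.inr (Or.inr (Or.inr h3)))
    · rcases lt_or_gt_of_ne (G.ne_of_adj ht) with h4 | h4
      · exact Or.inr (Or.inr (Or.inl ⟨h4, h2, w, ht.symm⟩))
      · exact Or.inr (Or.inr (Or.inr (Or.inl ⟨h3, h4, w, ht.symm⟩)))

end Crossing

/-- The chord from the first to the last vertex is uncrossed. Some vertex has degree at least three,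
and its closed neighbourhood keeps two vertices after the ends of the chord are removed. -/
lemma SmallDegreeCondition.exists_uncrossed [Finite V] (h : G.SmallDegreeCondition)
    (hne : ∃ u v, G.Adj u v) : ∃ a b, G.Uncrossed a b ∧ 2 ≤ (G.inner a b).ncard := by
  obtain ⟨u, hu⟩ := hne
  obtain ⟨v, hv⟩ : ∃ v, 3 ≤ (G.neighborSet v).ncard := by
    by_contra! hcon
    obtain ⟨a, b, hN⟩ : ∃ a b, ∀ w, G.Adj u w → w = a ∨ w = b := by
      have h3 := hcon u
      obtain ⟨w, hw⟩ := hu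
      have h0 : (G.neighborSet u).ncard ≠ 0 := Set.ncard_ne_zero_of_mem (a := w) hw
      obtain h1 | h1 : (G.neighborSet u).ncard = 1 ∨ (G.neighborSet u).ncard = 2 := by omega
      · obtain ⟨a, ha⟩ := Set.ncard_eq_one.1 h1
        refine ⟨a, a, fun w hw => ?_⟩
        have : w ∈ G.neighborSet u := hw
        simpa [ha] using this
      · obtain ⟨a, b, -, ha⟩ := Set.ncard_eq_two.1 h1
        refine ⟨a, b, fun w hw => ?_⟩
        have : w ∈ G.neighborSet u := hw
        simpa [ha] using this
    have := (h.adj hu hN).2.2.1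
    have := hcon a
    omega
  obtain ⟨a, -, ha⟩ := Set.exists_min_image Set.univ id (Set.toFinite (Set.univ : Set V)) ⟨u, trivial⟩
  obtain ⟨b, -, hb⟩ := Set.exists_max_image Set.univ id (Set.toFinite (Set.univ : Set V)) ⟨u, trivial⟩
  refine ⟨a, b, fun s t _ _ => ⟨ha t trivial, hb t trivial⟩, ?_⟩
  have hsub : insert v (G.neighborSet v) \ {a, b} ⊆ G.inner a b := by
    rintro w ⟨hw, hne⟩
    simp only [Set.mem_insert_iff, Set.mem_singleton_iff, not_or] at hne
    refine ⟨lt_of_le_of_ne (ha w trivial) (Ne.symm hne.1), lt_of_le_of_ne (hb w trivial) hne.2, ?_⟩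
    rcases hw with rfl | hw
    · obtain ⟨x, hx⟩ := Set.nonempty_of_ncard_ne_zero (s := G.neighborSet w) (by omega)
      exact ⟨x, hx⟩
    · exact ⟨v, hw.symm⟩
  have h1 := Set.ncard_le_ncard hsub
  have h2 := Set.le_ncard_sdiff {a, b} (insert v (G.neighborSet v))
  have h3 := Set.ncard_insert_le a {b}
  rw [Set.ncard_singleton] at h3
  rw [Set.ncard_insert_of_notMem (show v ∉ G.neighborSet v from fun hv => G.irrefl hv)] at h2
  omega

/-- The unavoidable configurations. -/
theorem CrossesAtMostOnce.hasTwins_or_hasChain [Finite V] (hG : G.CrossesAtMostOnce)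
    (h : G.SmallDegreeCondition) (hne : ∃ u v, G.Adj u v) : G.HasTwins ∨ G.HasChain := by
  obtain ⟨a₀, b₀, hab₀, h2₀⟩ := h.exists_uncrossed hne
  obtain ⟨⟨a, b⟩, ⟨hab, h2⟩, hmin⟩ := Set.exists_min_image
    {e : V × V | G.Uncrossed e.1 e.2 ∧ 2 ≤ (G.inner e.1 e.2).ncard}
    (fun e => (G.inner e.1 e.2).ncard) (Set.toFinite _) ⟨(a₀, b₀), hab₀, h2₀⟩
  replace hmin : ∀ u v, G.Uncrossed u v → G.inner u v ⊂ G.inner a b →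
      (G.inner u v).ncard ≤ 1 := by
    intro u v huv hss
    by_contra! hlt
    exact absurd (hmin (u, v) ⟨huv, hlt⟩) (not_le.2 (Set.ncard_lt_ncard hss))
  simp only at hab h2
  obtain ⟨u, v, w, z, hau, huv, hvw, hwz, hzb, huw, hvz⟩ := h.exists_crossing hab h2 hmin
  obtain ⟨huz, U1, U2, U3⟩ := hG.uncrossed huv hvw hwz huw hvz
  obtain ⟨hNv, hNw⟩ := hG.neighbors huv hvw hwz huw hvz
  have hvI : v ∈ G.inner a b := ⟨hau.trans_lt huv, ((hvw.trans hwz).trans_le hzb), z, hvz⟩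
  have hwI : w ∈ G.inner a b :=
    ⟨hau.trans_lt (huv.trans hvw), hwz.trans_le hzb, u, huw.symm⟩
  have s1 : G.inner u v ⊂ G.inner a b :=
    ⟨fun t ht => ⟨hau.trans_lt ht.1, ht.2.1.trans hvI.2.1, ht.2.2⟩,
      fun hs => lt_irrefl _ (hs hvI).2.1⟩
  have s2 : G.inner v w ⊂ G.inner a b :=
    ⟨fun t ht => ⟨hvI.1.trans ht.1, ht.2.1.trans hwI.2.1, ht.2.2⟩,
      fun hs => lt_irrefl _ (hs hvI).1⟩
  have s3 : G.inner w z ⊂ G.inner a b :=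
    ⟨fun t ht => ⟨hwI.1.trans ht.1, ht.2.1.trans_le hzb, ht.2.2⟩,
      fun hs => lt_irrefl _ (hs hwI).1⟩
  have I1 := h.inner_eq U1 (hmin _ _ U1 s1)
  have I2 := h.inner_eq U2 (hmin _ _ U2 s2)
  have I3 := h.inner_eq U3 (hmin _ _ U3 s3)
  -- The case distinction is whether the middle chord `vw` spans a vertex. If not, a vertex spanned
  -- by `uv` or `wz` would force degree five at `v` or `w`, where only four neighbours are possible.
  rcases I2 with e2 | ⟨q, e2, hvq, hqw, hqv, hqw', hNq, d1, d2⟩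
  · have e1 : G.inner u v = ∅ := by
      rcases I1 with e1 | ⟨p, e1, -, -, -, -, -, -, d⟩
      · exact e1
      · rw [e1, e2] at hNv
        have := ncard_neighborSet_le_length [u, z, p, w] fun t ht => by simpa using hNv t ht
        simp at this
        omega
    have e3 : G.inner w z = ∅ := by
      rcases I3 with e3 | ⟨r, e3, -, -, -, -, -, d, -⟩
      · exact e3
      · rw [e3, e2] at hNw
        have := ncard_neighborSet_le_length [u, z, r, v] fun t ht => by simpa using hNw t ht
        simp at this
        omega
    left
    simp only [e1, e2, e3, Set.mem_empty_iff_false, false_or] at hNv hNw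
    have dv := ncard_neighborSet_le_length [u, z, w] fun t ht => by simpa using hNv t ht
    have dw := ncard_neighborSet_le_length [u, z, v] fun t ht => by simpa using hNw t ht
    simp only [List.length_cons, List.length_nil] at dv dw
    -- Otherwise `v` has at most the neighbours `w` and `z`, so `w` would need degree five, but it
    -- has at most three neighbours.
    have hvu : G.Adj v u := by
      by_contra hvu
      have := (h.adj ⟨z, hvz⟩ (a := w) (b := z) fun t ht => ?_).2.2.1
      · omega
      · rcases hNv t ht with rfl | rfl | rfl
        exacts [absurd ht hvu, Or.inr rfl, Or.inl rfl]
    have hwz' : G.Adj w z := by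
      by_contra hwz'
      have := (h.adj ⟨u, huw.symm⟩ (a := v) (b := u) fun t ht => ?_).2.2.1
      · omega
      · rcases hNw t ht with rfl | rfl | rfl
        exacts [Or.inr rfl, absurd ht hwz', Or.inl rfl]
    exact ⟨u, z, v, w, ((huv.trans hvw).trans hwz).ne, hvw.ne, hvu, hvz, huw.symm, hwz', hNv, hNw⟩
  · right
    rcases I1 with e1 | ⟨p, e1, hup, hpv, hpu, hpv', hNp, -, -⟩
    · rw [e1, e2] at hNv
      have := ncard_neighborSet_le_length [u, z, q, w] fun t ht => by simpa using hNv t ht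
      simp at this
      omega
    rcases I3 with e3 | ⟨r, e3, hwr, hrz, hrw, hrz', hNr, -, -⟩
    · rw [e3, e2] at hNw
      have := ncard_neighborSet_le_length [u, z, q, v] fun t ht => by simpa using hNw t ht
      simp at this
      omega
    simp only [e1, e2, e3, Set.mem_singleton_iff] at hNv hNw
    -- The vertex `q` forces degree five at `v`, so all five possible neighbours occur.
    have hvu : G.Adj v u := by
      by_contra hvu
      have := ncard_neighborSet_le_length (v := v) [z, p, q, w] fun t ht => by
        rcases hNv t ht with rfl | ht
        exacts [absurd ht hvu, by simpa using ht]
      simp at this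
      omega
    have hwz' : G.Adj w z := by
      by_contra hwz'
      have := ncard_neighborSet_le_length (v := w) [u, r, q, v] fun t ht => by
        rcases hNw t ht with rfl | rfl | ht'
        exacts [by simp, absurd ht hwz', by simp; tauto]
      simp at this
      omega
    refine ⟨u, p, v, q, w, r, z, ?_, hpu, hvu, huw.symm, hvz, hwz', hrz', hNp, hNq, hNr, hNv, hNw⟩
    have hsort : [u, p, v, q, w, r, z].Pairwise (· < ·) :=
      List.isChain_iff_pairwise.1 (by simp [*])
    exact hsort.imp ne_of_lt

end SimpleGraph

/-! ### The induction and the theorem -/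

namespace SimpleGraph

theorem CrossesAtMostOnce.exists_isTotalColoring {V α : Type*} [LinearOrder V] [Finite V]
    [Fintype α] {G : SimpleGraph V} (hG : G.CrossesAtMostOnce) (h6 : 6 ≤ Fintype.card α)
    (hdeg : ∀ v, (G.neighborSet v).ncard + 1 ≤ Fintype.card α) :
    ∃ T : Sym2 V → α, G.IsTotalColoring T := by
  induction G using WellFoundedLT.induction with
  | _ G ih =>
  have ih' : ∀ H < G, ∃ T : Sym2 V → α, H.IsTotalColoring T := by
    refine fun H hH => ih H hH ?_ fun v => ?_
    · exact fun a c b d b' d' h1 h2 h3 => hG a c b d b' d' (hH.le h1) (hH.le h2) (hH.le h3)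
    · exact (Nat.add_le_add_right (Set.ncard_le_ncard (fun w hw => hH.le hw)
        (Set.toFinite _)) 1).trans (hdeg v)
  by_cases hne : ∃ u v, G.Adj u v
  · by_cases hS : G.SmallDegreeCondition
    · rcases hG.hasTwins_or_hasChain hS hne with
        ⟨a, b, x, y, hab, hxy, hxa, hxb, hya, hyb, hNx, hNy⟩ |
        ⟨a, p, x, q, y, r, b, hnd, hpa, hxa, hya, hxb, hyb, hrb, hNp, hNq, hNr, hNx, hNy⟩
      · exact exists_isTotalColoring_of_twins h6 hdeg ih' hab hxy hxa hxb hya hyb hNx hNy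
      · exact exists_isTotalColoring_of_chain h6 hdeg ih' hnd hpa hxa hya hxb hyb hrb hNp hNq hNr
          hNx hNy
    · unfold SmallDegreeCondition at hS
      push Not at hS
      obtain ⟨v, a, b, hva, hvb, hN, ha⟩ := hS
      -- Failure of the condition gives `a` degree at most four when `a ≠ b`, which is at most the
      -- number of colors minus two.
      refine exists_isTotalColoring_of_degree_le_two h6 hdeg ih' hva hvb hN fun hab => ?_
      have := ha hab
      omega
  · push Not at hne
    obtain ⟨k⟩ : Nonempty α := Fintype.card_pos_iff.1 (by omega)
    refine ⟨fun _ => k, fun v w w' hw hw' hww => ?_, fun u v huv => absurd huv (hne u v)⟩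
    rcases hw with rfl | hw
    · rcases hw' with rfl | hw'
      exacts [absurd rfl hww, absurd hw' (hne _ _)]
    · exact absurd hw (hne _ _)

theorem IsPseudoOuterplanar.totalColorable {V : Type*} [Fintype V] {G : SimpleGraph V}
    [DecidableRel G.Adj] (hG : G.IsPseudoOuterplanar) {M : ℕ} (hΔ : G.maxDegree ≤ M) (hM : 5 ≤ M) :
    G.TotalColorable (M + 1) := by
  obtain ⟨p, hp, hcross⟩ := hG.exists_layout
  let _ : LinearOrder V := LinearOrder.lift' p (Set.injOn_univ.1 hp)
  have hC : G.CrossesAtMostOnce := fun a c b d b' d' h1 h2 h3 h4 h5 =>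
    hcross a trivial c trivial b trivial d trivial b' trivial d' trivial h1 h2 h3 h4 h5
  obtain ⟨T, hT⟩ := hC.exists_isTotalColoring (α := Fin (M + 1)) (by simpa using hM) fun v => by
    rw [Fintype.card_fin, Set.ncard_eq_toFinset_card', Set.toFinset_card, card_neighborSet_eq_degree]
    have := G.degree_le_maxDegree v
    omega
  exact ⟨hT.toTotalColoring⟩

end SimpleGraph

theorem mainTheorem1 {V : Type*} [Fintype V] (G : SimpleGraph V) [DecidableRel G.Adj]
    (hG : G.IsPseudoOuterplanar) (M : ℕ) (hΔ : G.maxDegree ≤ M) (hM : 5 ≤ M) :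
    G.TotalColorable (M + 1) ∧ G.totalChromaticNumber ≤ ((M + 1 : ℕ) : ℕ∞) := by
  have h := hG.totalColorable hΔ hM
  exact ⟨h, iInf₂_le (M + 1) ⟨Nat.succ_pos M, h⟩⟩
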